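/- **Setting.** An orthogonal category $\mathbf C^\perp=(\mathbf C,\perp)$ is a small category $\mathbf C$ with a set $\perp$ of cospans $(U_1\to V)\perp(U_2\to V)$ that is closed under transposition and under pre- and post-composition. Let $G$ be a discrete group acting on $\mathbf C^\perp$ by orthogonal functors $\alpha_g$ with $\alpha_e=\mathrm{id}$ and $\alpha_{g'}\alpha_g=\alpha_{g'g}$, i.e. by a functor $\mathsf BG\to\mathbf{Cat}^\perp$, and assume that $\mathbf C$ is filtered. An AQFT over $\mathbf C^\perp$ is a functor $\mathfrak A$ from $\mathbf C$ to unital $C^*$-algebras such that $\mathfrak A(f_1)(a)$ and $\mathfrak A(f_2)(b)$ commute whenever $f_1\perp f_2$. Let $(\mathfrak A,\Psi)$ be a $G$-equivariant AQFT, i.e. an object of the bicategorical limit of $(\mathsf BG)^{\mathrm{op}}\to\mathbf{CAT}$, $\mathbf C^\perp\mapsto\mathbf{AQFT}(\mathbf C^\perp)$: an AQFT with isomorphisms $\Psi_g:\mathfrak A\cong\alpha_g^*\mathfrak A$ satisfying $\Psi_e=\mathrm{id}$ and $\Psi_{g'g}=\alpha_g^*(\Psi_{g'})\circ\Psi_g$.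 Let $\mathfrak A_\star=\mathrm{colim}\,\mathfrak A$ be the colimit in unital $C^*$-algebras, with canonical maps $\iota_U:\mathfrak A(U)\to\mathfrak A_\star$ and with $\Psi_{\star g}:\mathfrak A_\star\to\mathfrak A_\star$ determined by $\Psi_{\star g}\iota_U=\iota_{\alpha_g(U)}(\Psi_g)_U$. Let $\pi_0:\mathfrak A_\star\to \mathrm B(H_0)$ be a representation on a complex Hilbert space, $\pi_{0U}=\pi_0\iota_U$, $R(U)=\pi_{0U}(\mathfrak A(U))''$, and let $R_\star\subseteq \mathrm B(H_0)$ be the universal algebra of this net of inclusions, i.e. the norm closure of $\bigcup_U R(U)$. **Assumptions.** 1. For every $U$ there is an orthogonal cospan $(U'\to V)\perp(U\to V)$. 2. Every $\pi_{0U}$ is faithful. 3. Haag duality: for every $U$, $R(U)=\bigcap \pi_{0U'}(\mathfrak A(U'))'$, where the intersection is over all orthogonal cospans $(U'\to V)\perp(U\to V)$. 4. For every $(U_1\to \widetilde U)\perp(U_2\to\widetilde U)$ there are a morphism $\widetilde U\to W$ and orthogonal cospans $(V_1\to W)\perp(V_2\to W)$, $(U_1'\to V_1)\perp(U_1\to V_1)$,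 $(U_2\to V_2)\perp(U_2'\to V_2)$ such that $(U_i'\to V_i\to W)\perp(\widetilde U\to W)$ for $i=1,2$. 5. $u:G\to \mathrm{PU}(H_0)$ is a projective unitary representation with $\pi_0\Psi_{\star g}=\mathrm{Ad}_{u_g}\pi_0$ for all $g\in G$. **Sectors.** For $U\in\mathbf C$ let $\mathbf{SSS}(U)$ be the $C^*$-category whose objects are the $*$-endomorphisms $\rho$ of $R_\star$ such that * for every $\widetilde U\in\mathbf C$ there is a unitary $v$ on $H_0$ with $v\,\rho(a)=a\,v$ for all $(\widetilde U'\to V)\perp(\widetilde U\to V)$ and all $a\in R(\widetilde U')$, and * $\rho(a)=a$ for all $(U'\to V)\perp(U\to V)$ and all $a\in R(U')$, and whose morphisms $\rho\to\rho'$ are the $T\in R(U)$ with $T\rho(a)=\rho'(a)T$ for all $a\in R_\star$, with composition, norm and involution of operators. A morphism $U\to V$ induces an inclusion $\mathbf{SSS}(U)\subseteq\mathbf{SSS}(V)$. **Prefactorization algebras.** An operation $\underline f:(U_1,\dots,U_n)\to V$ is a tuple of morphisms $f_i:U_i\to V$ with $f_i\perp f_j$ for $i\ne j$. A prefactorization algebra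 with values in strict monoidal $C^*$-categories assigns to each $U$ a strict monoidal $C^*$-category $\mathfrak F(U)$ and to each operation a strict monoidal $*$-functor $\bigotimes_i\mathfrak F(U_i)\to\mathfrak F(V)$ (maximal tensor product), compatibly with operadic composition, identities and permutations. Morphisms are families of strict monoidal $*$-functors $\mathfrak F(U)\to\mathfrak F'(U)$ compatible with these. It is locally constant if every $1$-ary operation is sent to a unitary equivalence. A $G$-equivariant one is an object of the bicategorical limit over $(\mathsf BG)^{\mathrm{op}}$ of the categories of prefactorization algebras over $\mathbf C^\perp$, that is, a prefactorization algebra $\mathfrak F$ with isomorphisms $\Phi_g:\mathfrak F\cong\alpha_g^*\mathfrak F$ such that $\Phi_e=\mathrm{id}$ and $\Phi_{g'g}=\alpha_g^*(\Phi_{g'})\circ\Phi_g$. **Theorem.** Under these assumptions: * $\rho\diamond\dot\rho=\rho\,\dot\rho$, $\;T\diamond\dot T=T\,\rho(\dot T)$ (for $T:\rho\to\rho'$) and $\mathbb 1=\mathrm{id}$ define a strict monoidal structure on every $C^*$-category $\mathbf{SSS}(U)$; * the functors $\bigotimes_i\mathbf{SSS}(U_i)\to\mathbf{SSS}(V)^{\otimes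 n}\xrightarrow{\ \diamond^n\ }\mathbf{SSS}(V)$ given by the inclusions followed by the $n$-fold product (the unit for $n=0$) make $\mathbf{SSS}$ a locally constant prefactorization algebra over $\mathbf C^\perp$ with values in strict monoidal $C^*$-categories; * each $\mathrm{Ad}_{u_g}$ preserves $R_\star$, and $$g\triangleright\rho=\mathrm{Ad}_{u_g}\,\rho\,\mathrm{Ad}_{u_g^*},\qquad g\triangleright T=\mathrm{Ad}_{u_g}(T)$$ define isomorphisms $\mathbf{SSS}\cong\alpha_g^*\,\mathbf{SSS}$, $g\in G$, which endow this prefactorization algebra with the structure of a $G$-equivariant locally constant prefactorization algebra. -/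

import Mathlib

open CategoryTheory Opposite

set_option linter.checkUnivs false

universe w v u v' u' v₁ u₁

/-! ### Orthogonal categories -/

/-- An orthogonality relation on a category: a set of cospans which is closed under transposition
and under pre- and post-composition. -/
structure Orthogonality (C : Type u) [Category.{v} C] where
  rel : ∀ {U₁ U₂ V : C}, (U₁ ⟶ V) → (U₂ ⟶ V) → Prop
  symm : ∀ {U₁ U₂ V : C} {f₁ : U₁ ⟶ V} {f₂ : U₂ ⟶ V}, rel f₁ f₂ → rel f₂ f₁
  precomp : ∀ {W₁ W₂ U₁ U₂ V : C} {f₁ : U₁ ⟶ V} {f₂ : U₂ ⟶ V} (g₁ : W₁ ⟶ U₁) (g₂ : W₂ ⟶ U₂),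
    rel f₁ f₂ → rel (g₁ ≫ f₁) (g₂ ≫ f₂)
  postcomp : ∀ {U₁ U₂ V V' : C} {f₁ : U₁ ⟶ V} {f₂ : U₂ ⟶ V} (h : V ⟶ V'),
    rel f₁ f₂ → rel (f₁ ≫ h) (f₂ ≫ h)

/-- Orthogonal categories. -/
structure OrthCat where
  carrier : Type u
  [cat : Category.{v} carrier]
  orth : Orthogonality carrier

namespace OrthCat

instance : CoeSort OrthCat.{v, u} (Type u) := ⟨OrthCat.carrier⟩

instance (C : OrthCat.{v, u}) : Category.{v} C := C.cat

/-- The orthogonality relation `f₁ ⟂ f₂`. -/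
def Perp (C : OrthCat.{v, u}) {U₁ U₂ V : C} (f₁ : U₁ ⟶ V) (f₂ : U₂ ⟶ V) : Prop :=
  C.orth.rel f₁ f₂

/-- Orthogonal functors: functors which preserve orthogonal cospans. -/
@[ext]
structure Hom (C D : OrthCat.{v, u}) where
  functor : C ⥤ D
  map_perp : ∀ {U₁ U₂ V : C} {f₁ : U₁ ⟶ V} {f₂ : U₂ ⟶ V},
    C.Perp f₁ f₂ → D.Perp (functor.map f₁) (functor.map f₂)

/-- The category of orthogonal categories and orthogonal functors. -/
instance : Category OrthCat.{v, u} where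
  Hom := Hom
  id C := ⟨𝟭 C, fun h => h⟩
  comp F G := ⟨F.functor ⋙ G.functor, fun h => G.map_perp (F.map_perp h)⟩

/-- Operations of the prefactorization operad from the tuple `U = (U₁, …, Uₙ)` to `V`: tuples of
morphisms which are pairwise orthogonal. -/
def Op (C : OrthCat.{v, u}) {n : ℕ} (U : Fin n → C) (V : C) : Type v :=
  {f : ∀ i, U i ⟶ V // ∀ i j, i ≠ j → C.Perp (f i) (f j)}

namespace Op

variable {C : OrthCat.{v, u}}

/-- The `1`-ary operation given by a morphism. -/
def single {U V : C} (f : U ⟶ V) : C.Op (fun _ : Fin 1 => U) V :=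
  ⟨fun _ => f, fun _ _ h => absurd (Subsingleton.elim _ _) h⟩

/-- Operadic composition. The concatenated tuple is indexed by `Fin (k₁ + ⋯ + kₙ)`, which is
identified with the pairs `(i, l)`, `l < kᵢ`, in lexicographic order. -/
def comp {n : ℕ} {U : Fin n → C} {V : C} (f : C.Op U V) {k : Fin n → ℕ}
    {W : ∀ i, Fin (k i) → C} (g : ∀ i, C.Op (W i) (U i)) :
    C.Op (fun j : Fin (∑ i, k i) =>
      W (finSigmaFinEquiv.symm j).1 (finSigmaFinEquiv.symm j).2) V :=
  ⟨fun j => (g (finSigmaFinEquiv.symm j).1).1 (finSigmaFinEquiv.symm j).2 ≫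
      f.1 (finSigmaFinEquiv.symm j).1, by
    intro j j' hjj'
    have hne : finSigmaFinEquiv.symm j ≠ finSigmaFinEquiv.symm j' :=
      fun h => hjj' (finSigmaFinEquiv.symm.injective h)
    show C.Perp ((g (finSigmaFinEquiv.symm j).1).1 (finSigmaFinEquiv.symm j).2 ≫
      f.1 (finSigmaFinEquiv.symm j).1) ((g (finSigmaFinEquiv.symm j').1).1
        (finSigmaFinEquiv.symm j').2 ≫ f.1 (finSigmaFinEquiv.symm j').1)
    generalize finSigmaFinEquiv.symm j = p at hne ⊢
    generalize finSigmaFinEquiv.symm j' = q at hne ⊢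
    obtain ⟨i, l⟩ := p
    obtain ⟨i', l'⟩ := q
    by_cases hi : i = i'
    · subst hi
      have hl : l ≠ l' := fun h => hne (by rw [h])
      exact C.orth.postcomp _ ((g i).2 l l' hl)
    · exact C.orth.precomp _ _ (f.2 i i' hi)⟩

/-- The permutation action. -/
def perm {n : ℕ} {U : Fin n → C} {V : C} (f : C.Op U V) (σ : Equiv.Perm (Fin n)) :
    C.Op (fun i => U (σ i)) V :=
  ⟨fun i => f.1 (σ i), fun _ _ h => f.2 _ _ (fun h' => h (σ.injective h'))⟩

/-- The action of an orthogonal functor on operations. -/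
def mapHom {D : OrthCat.{v, u}} (α : C ⟶ D) {n : ℕ} {U : Fin n → C} {V : C} (f : C.Op U V) :
    D.Op (fun i => α.functor.obj (U i)) (α.functor.obj V) :=
  ⟨fun i => α.functor.map (f.1 i), fun _ _ h => α.map_perp (f.2 _ _ h)⟩

end Op

end OrthCat

/-! ### Bicategorical limits of strict diagrams of categories -/

/-- The data exhibiting a family `x j ∈ Φ(j)` as an object of the bicategorical limit (the category
of pseudo-cones with vertex a point) of a diagram of categories: coherent isomorphisms
`x j' ≅ Φ(f)(x j)` for all `f : j ⟶ j'`. -/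
structure BilimStr {J : Type u₁} [Category.{v₁} J] (Φ : J ⥤ Cat.{v, u}) (x : ∀ j, Φ.obj j) where
  iso : ∀ {j j' : J} (f : j ⟶ j'), x j' ≅ (Φ.map f).toFunctor.obj (x j)
  iso_id : ∀ j : J, (iso (𝟙 j)).hom =
    eqToHom (show x j = (Φ.map (𝟙 j)).toFunctor.obj (x j) by rw [Φ.map_id]; rfl)
  iso_comp : ∀ {j j' j'' : J} (f : j ⟶ j') (h : j' ⟶ j''),
    (iso (f ≫ h)).hom ≫
        eqToHom (show (Φ.map (f ≫ h)).toFunctor.obj (x j) =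
          (Φ.map h).toFunctor.obj ((Φ.map f).toFunctor.obj (x j)) by rw [Φ.map_comp]; rfl) =
      (iso h).hom ≫ (Φ.map h).toFunctor.map (iso f).hom

/-- Objects of the bicategorical limit of a diagram of categories. -/
structure Bilim {J : Type u₁} [Category.{v₁} J] (Φ : J ⥤ Cat.{v, u}) where
  obj : ∀ j, Φ.obj j
  str : BilimStr Φ obj

namespace Bilim

variable {J : Type u₁} [Category.{v₁} J] {Φ : J ⥤ Cat.{v, u}}

/-- Morphisms in the bicategorical limit. -/
@[ext]
structure Hom (X Y : Bilim Φ) where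
  app : ∀ j, X.obj j ⟶ Y.obj j
  comm : ∀ {j j' : J} (f : j ⟶ j'),
    (X.str.iso f).hom ≫ (Φ.map f).toFunctor.map (app j) = app j' ≫ (Y.str.iso f).hom

/-- The bicategorical limit as a category. -/
instance : Category (Bilim Φ) where
  Hom := Hom
  id X := ⟨fun _ => 𝟙 _, fun f => by simp⟩
  comp ζ ξ := ⟨fun j => ζ.app j ≫ ξ.app j, fun f => by
    rw [Functor.map_comp, ← Category.assoc, ζ.comm, Category.assoc, ξ.comm, Category.assoc]⟩
  id_comp _ := Hom.ext (funext fun _ => Category.id_comp _)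
  comp_id _ := Hom.ext (funext fun _ => Category.comp_id _)
  assoc _ _ _ := Hom.ext (funext fun _ => Category.assoc _ _ _)

end Bilim

/-! ### `C*`-algebras and AQFTs -/

/-- Unital `C*`-algebras. -/
structure CStarAlgCat where
  carrier : Type w
  [alg : CStarAlgebra carrier]

namespace CStarAlgCat

instance : CoeSort CStarAlgCat.{w} (Type w) := ⟨CStarAlgCat.carrier⟩

noncomputable instance (A : CStarAlgCat.{w}) : CStarAlgebra A := A.alg

/-- Unital `*`-homomorphisms. -/
@[ext]
structure Hom (A B : CStarAlgCat.{w}) where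
  hom : A →⋆ₐ[ℂ] B

/-- The category of unital `C*`-algebras and unital `*`-homomorphisms. -/
noncomputable instance : Category CStarAlgCat.{w} where
  Hom := Hom
  id A := ⟨StarAlgHom.id ℂ A⟩
  comp f g := ⟨g.hom.comp f.hom⟩

end CStarAlgCat

/-- `⟂`-commutativity of a functor with values in `C*`-algebras. -/
def PerpCommutative (C : OrthCat.{v, u}) : ObjectProperty (C ⥤ CStarAlgCat.{w}) := fun F =>
  ∀ {U₁ U₂ V : C} (f₁ : U₁ ⟶ V) (f₂ : U₂ ⟶ V), C.Perp f₁ f₂ →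
    ∀ (a : F.obj U₁) (b : F.obj U₂), Commute ((F.map f₁).hom a) ((F.map f₂).hom b)

/-- The category of AQFTs over `C`: the full subcategory of `⟂`-commutative functors. -/
abbrev AQFT (C : OrthCat.{v, u}) := (PerpCommutative.{w} C).FullSubcategory

/-- Pullback of AQFTs along an orthogonal functor. -/
noncomputable def AQFT.pullback {C D : OrthCat.{v, u}} (α : C ⟶ D) : AQFT.{w} D ⥤ AQFT.{w} C where
  obj A := ⟨α.functor ⋙ A.obj, fun f₁ f₂ h a b =>
    A.property (α.functor.map f₁) (α.functor.map f₂) (α.map_perp h) a b⟩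
  map ζ := ObjectProperty.homMk (Functor.whiskerLeft α.functor ζ.hom)

/-- The assignment `C ↦ AQFT(C)`. -/
noncomputable def aqftFunctor : OrthCat.{v, u}ᵒᵖ ⥤ Cat where
  obj C := Cat.of (AQFT.{w} C.unop)
  map α := (AQFT.pullback.{w} α.unop).toCatHom
  map_id _ := rfl
  map_comp _ _ := rfl

/-! ### Strict monoidal `C*`-categories -/

/-- The structure of a `C*`-category: the morphism spaces are complex Banach spaces, composition is
bilinear and submultiplicative, and there is a conjugate linear contravariant involution `†` that
is the identity on objects, satisfies the `C*`-identity, and for which `f† ∘ f` is a positive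
element of the endomorphism `C*`-algebra. -/
class CStarCategory (C : Type u) [Category.{v} C] where
  [normed : ∀ X Y : C, NormedAddCommGroup (X ⟶ Y)]
  [space : ∀ X Y : C, NormedSpace ℂ (X ⟶ Y)]
  [complete : ∀ X Y : C, CompleteSpace (X ⟶ Y)]
  add_comp : ∀ {X Y Z : C} (f f' : X ⟶ Y) (g : Y ⟶ Z), (f + f') ≫ g = f ≫ g + f' ≫ g
  comp_add : ∀ {X Y Z : C} (f : X ⟶ Y) (g g' : Y ⟶ Z), f ≫ (g + g') = f ≫ g + f ≫ g'
  smul_comp : ∀ {X Y Z : C} (z : ℂ) (f : X ⟶ Y) (g : Y ⟶ Z), (z • f) ≫ g = z • (f ≫ g)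
  comp_smul : ∀ {X Y Z : C} (z : ℂ) (f : X ⟶ Y) (g : Y ⟶ Z), f ≫ (z • g) = z • (f ≫ g)
  norm_comp_le : ∀ {X Y Z : C} (f : X ⟶ Y) (g : Y ⟶ Z), ‖f ≫ g‖ ≤ ‖f‖ * ‖g‖
  dagger : ∀ {X Y : C}, (X ⟶ Y) → (Y ⟶ X)
  dagger_add : ∀ {X Y : C} (f f' : X ⟶ Y), dagger (f + f') = dagger f + dagger f'
  dagger_smul : ∀ {X Y : C} (z : ℂ) (f : X ⟶ Y), dagger (z • f) = (starRingEnd ℂ z) • dagger f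
  dagger_dagger : ∀ {X Y : C} (f : X ⟶ Y), dagger (dagger f) = f
  dagger_comp : ∀ {X Y Z : C} (f : X ⟶ Y) (g : Y ⟶ Z), dagger (f ≫ g) = dagger g ≫ dagger f
  norm_comp_dagger : ∀ {X Y : C} (f : X ⟶ Y), ‖f ≫ dagger f‖ = ‖f‖ * ‖f‖
  positive : ∀ {X Y : C} (f : X ⟶ Y), ∃ g : X ⟶ X, f ≫ dagger f = g ≫ dagger g

attribute [reducible, instance] CStarCategory.normed CStarCategory.space
attribute [instance] CStarCategory.complete

open CStarCategory

/-- Bundled `C*`-categories. -/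
structure CStarCat where
  carrier : Type u
  [cat : Category.{v} carrier]
  [cstar : CStarCategory carrier]

instance : CoeSort CStarCat.{v, u} (Type u) := ⟨CStarCat.carrier⟩
instance (A : CStarCat.{v, u}) : Category.{v} A := A.cat
noncomputable instance (A : CStarCat.{v, u}) : CStarCategory A := A.cstar

/-- A morphism of a `C*`-category is unitary. -/
def IsUnitaryMor {A : CStarCat.{v, u}} {X Y : A} (f : X ⟶ Y) : Prop :=
  f ≫ dagger f = 𝟙 X ∧ dagger f ≫ f = 𝟙 Y

/-- A strict monoidal structure on a `C*`-category: a strictly associative and unital product which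
is a bilinear `*`-functor. -/
structure StrictMonoidal (A : CStarCat.{v, u}) where
  tensorObj : A → A → A
  unit : A
  tensorHom : ∀ {X X' Y Y' : A}, (X ⟶ X') → (Y ⟶ Y') → (tensorObj X Y ⟶ tensorObj X' Y')
  tensor_id : ∀ X Y : A, tensorHom (𝟙 X) (𝟙 Y) = 𝟙 (tensorObj X Y)
  tensor_comp : ∀ {X X' X'' Y Y' Y'' : A} (f : X ⟶ X') (f' : X' ⟶ X'') (g : Y ⟶ Y')
    (g' : Y' ⟶ Y''), tensorHom (f ≫ f') (g ≫ g') = tensorHom f g ≫ tensorHom f' g'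
  add_tensor : ∀ {X X' Y Y' : A} (f f' : X ⟶ X') (g : Y ⟶ Y'),
    tensorHom (f + f') g = tensorHom f g + tensorHom f' g
  tensor_add : ∀ {X X' Y Y' : A} (f : X ⟶ X') (g g' : Y ⟶ Y'),
    tensorHom f (g + g') = tensorHom f g + tensorHom f g'
  smul_tensor : ∀ {X X' Y Y' : A} (z : ℂ) (f : X ⟶ X') (g : Y ⟶ Y'),
    tensorHom (z • f) g = z • tensorHom f g
  tensor_smul : ∀ {X X' Y Y' : A} (z : ℂ) (f : X ⟶ X') (g : Y ⟶ Y'),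
    tensorHom f (z • g) = z • tensorHom f g
  tensor_dagger : ∀ {X X' Y Y' : A} (f : X ⟶ X') (g : Y ⟶ Y'),
    tensorHom (dagger f) (dagger g) = dagger (tensorHom f g)
  assoc_obj : ∀ X Y Z : A, tensorObj (tensorObj X Y) Z = tensorObj X (tensorObj Y Z)
  assoc_hom : ∀ {X X' Y Y' Z Z' : A} (f : X ⟶ X') (g : Y ⟶ Y') (h : Z ⟶ Z'),
    HEq (tensorHom (tensorHom f g) h) (tensorHom f (tensorHom g h))
  unit_tensor_obj : ∀ X : A, tensorObj unit X = X
  unit_tensor_hom : ∀ {X X' : A} (f : X ⟶ X'), HEq (tensorHom (𝟙 unit) f) f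
  tensor_unit_obj : ∀ X : A, tensorObj X unit = X
  tensor_unit_hom : ∀ {X X' : A} (f : X ⟶ X'), HEq (tensorHom f (𝟙 unit)) f

namespace StrictMonoidal

variable {A : CStarCat.{v, u}} (M : StrictMonoidal A)

/-- The `n`-fold monoidal product of objects; it is the monoidal unit for `n = 0`. -/
def tensorPow : ∀ (n : ℕ), (Fin n → A) → A
  | 0, _ => M.unit
  | n + 1, x => M.tensorObj (x 0) (tensorPow n fun i => x i.succ)

/-- The `n`-fold monoidal product of morphisms. -/
def tensorPowHom : ∀ (n : ℕ) {x y : Fin n → A}, (∀ i, x i ⟶ y i) →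
    (M.tensorPow n x ⟶ M.tensorPow n y)
  | 0, _, _, _ => 𝟙 M.unit
  | n + 1, _, _, T => M.tensorHom (T 0) (tensorPowHom n fun i => T i.succ)

end StrictMonoidal

/-- Strict monoidal `C*`-categories. -/
structure MonCStarCat where
  cat : CStarCat.{v, u}
  mon : StrictMonoidal cat

instance : CoeSort MonCStarCat.{v, u} (Type u) := ⟨fun A => A.cat.carrier⟩
instance (A : MonCStarCat.{v, u}) : Category.{v} A := inferInstanceAs (Category A.cat)
noncomputable instance (A : MonCStarCat.{v, u}) : CStarCategory A :=
  inferInstanceAs (CStarCategory A.cat)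

/-- Strict monoidal `*`-functors `A₁ ⊗ ⋯ ⊗ Aₙ ⟶ B` out of the maximal tensor product of strict
monoidal `C*`-categories. By the universal property of the maximal tensor product, these are the
functors `A₁ × ⋯ × Aₙ ⟶ B` which are multilinear on morphisms, compatible with the involutions and
strictly compatible with the (component-wise) monoidal structures. For `n = 0` the empty tensor
product is the `C*`-category with one object and endomorphisms `ℂ`. -/
structure MultiFunctor {n : ℕ} (A : Fin n → MonCStarCat.{v, u}) (B : MonCStarCat.{v, u}) where
  obj : (∀ i, A i) → B
  map : ∀ {x y : ∀ i, A i}, MultilinearMap ℂ (fun i => x i ⟶ y i) (obj x ⟶ obj y)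
  map_id : ∀ x : ∀ i, A i, map (fun i => 𝟙 (x i)) = 𝟙 (obj x)
  map_comp : ∀ {x y z : ∀ i, A i} (S : ∀ i, x i ⟶ y i) (T : ∀ i, y i ⟶ z i),
    map (fun i => S i ≫ T i) = map S ≫ map T
  map_dagger : ∀ {x y : ∀ i, A i} (T : ∀ i, x i ⟶ y i),
    map (fun i => dagger (T i)) = dagger (map T)
  obj_unit : obj (fun i => (A i).mon.unit) = B.mon.unit
  obj_tensor : ∀ x y : ∀ i, A i,
    obj (fun i => (A i).mon.tensorObj (x i) (y i)) = B.mon.tensorObj (obj x) (obj y)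
  map_tensor : ∀ {x x' y y' : ∀ i, A i} (S : ∀ i, x i ⟶ x' i) (T : ∀ i, y i ⟶ y' i),
    HEq (map (fun i => (A i).mon.tensorHom (S i) (T i))) (B.mon.tensorHom (map S) (map T))

/-- Strict monoidal `*`-functors. -/
@[ext]
structure MonStarFunctor (A B : MonCStarCat.{v, u}) extends A ⥤ B where
  map_add : ∀ {x y : A} (S T : x ⟶ y), map (S + T) = map S + map T
  map_smul : ∀ {x y : A} (z : ℂ) (T : x ⟶ y), map (z • T) = z • map T
  map_dagger : ∀ {x y : A} (T : x ⟶ y), map (dagger T) = dagger (map T)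
  obj_unit : obj A.mon.unit = B.mon.unit
  obj_tensor : ∀ x y : A, obj (A.mon.tensorObj x y) = B.mon.tensorObj (obj x) (obj y)
  map_tensor : ∀ {x x' y y' : A} (S : x ⟶ x') (T : y ⟶ y'),
    HEq (map (A.mon.tensorHom S T)) (B.mon.tensorHom (map S) (map T))

theorem functor_map_heq {A : Type u} [Category.{v} A] {B : Type u'} [Category.{v'} B] (F : A ⥤ B)
    {x y x' y' : A} (hx : x = x') (hy : y = y') {T : x ⟶ y} {T' : x' ⟶ y'} (h : HEq T T') :
    HEq (F.map T) (F.map T') := by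
  subst hx hy
  rw [eq_of_heq h]

namespace MonStarFunctor

/-- The identity functor. -/
def id (A : MonCStarCat.{v, u}) : MonStarFunctor A A where
  toFunctor := 𝟭 A
  map_add _ _ := rfl
  map_smul _ _ := rfl
  map_dagger _ := rfl
  obj_unit := rfl
  obj_tensor _ _ := rfl
  map_tensor _ _ := HEq.rfl

/-- Composition of functors. -/
def comp {A B D : MonCStarCat.{v, u}} (F : MonStarFunctor A B) (K : MonStarFunctor B D) :
    MonStarFunctor A D where
  toFunctor := F.toFunctor ⋙ K.toFunctor
  map_add S T := by
    show K.map (F.map (S + T)) = _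
    rw [F.map_add, K.map_add]; rfl
  map_smul z T := by
    show K.map (F.map (z • T)) = _
    rw [F.map_smul, K.map_smul]; rfl
  map_dagger T := by
    show K.map (F.map (dagger T)) = _
    rw [F.map_dagger, K.map_dagger]; rfl
  obj_unit := (congrArg K.obj F.obj_unit).trans K.obj_unit
  obj_tensor x y := (congrArg K.obj (F.obj_tensor x y)).trans (K.obj_tensor _ _)
  map_tensor S T :=
    (functor_map_heq K.toFunctor (F.obj_tensor _ _) (F.obj_tensor _ _) (F.map_tensor S T)).trans
      (K.map_tensor _ _)

end MonStarFunctor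

/-! ### Prefactorization algebras with values in strict monoidal `C*`-categories -/

/-- The structure of a prefactorization algebra on a family of strict monoidal `C*`-categories,
i.e. of an algebra over the prefactorization operad: factorization products for all operations,
compatible with identities, operadic composition and permutations. -/
structure PFAStr (C : OrthCat.{v, u}) (F : C → MonCStarCat.{v', u'}) where
  prod : ∀ {n : ℕ} {U : Fin n → C} {V : C}, C.Op U V → MultiFunctor (fun i => F (U i)) (F V)
  id_obj : ∀ (V : C) (x : F V), (prod (.single (𝟙 V))).obj (fun _ => x) = x
  id_map : ∀ (V : C) {x y : F V} (T : x ⟶ y), HEq ((prod (.single (𝟙 V))).map (fun _ => T)) T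
  comp_obj : ∀ {n : ℕ} {U : Fin n → C} {V : C} (f : C.Op U V) {k : Fin n → ℕ}
    {W : ∀ i, Fin (k i) → C} (g : ∀ i, C.Op (W i) (U i)) (x : ∀ i l, F (W i l)),
    (prod (f.comp g)).obj (fun j => x (finSigmaFinEquiv.symm j).1 (finSigmaFinEquiv.symm j).2) =
      (prod f).obj (fun i => (prod (g i)).obj (x i))
  comp_map : ∀ {n : ℕ} {U : Fin n → C} {V : C} (f : C.Op U V) {k : Fin n → ℕ}
    {W : ∀ i, Fin (k i) → C} (g : ∀ i, C.Op (W i) (U i)) {x y : ∀ i l, F (W i l)}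
    (T : ∀ i l, x i l ⟶ y i l),
    HEq ((prod (f.comp g)).map
        (fun j => T (finSigmaFinEquiv.symm j).1 (finSigmaFinEquiv.symm j).2))
      ((prod f).map (fun i => (prod (g i)).map (T i)))
  perm_obj : ∀ {n : ℕ} {U : Fin n → C} {V : C} (f : C.Op U V) (σ : Equiv.Perm (Fin n))
    (x : ∀ i, F (U i)), (prod (f.perm σ)).obj (fun i => x (σ i)) = (prod f).obj x
  perm_map : ∀ {n : ℕ} {U : Fin n → C} {V : C} (f : C.Op U V) (σ : Equiv.Perm (Fin n))
    {x y : ∀ i, F (U i)} (T : ∀ i, x i ⟶ y i),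
    HEq ((prod (f.perm σ)).map (fun i => T (σ i))) ((prod f).map T)

/-- Local constancy: every `1`-ary operation is sent to a unitary equivalence, i.e. to a fully
faithful functor which is surjective on objects up to unitary isomorphism. -/
def PFAStr.IsLocallyConstant {C : OrthCat.{v, u}} {F : C → MonCStarCat.{v', u'}}
    (P : PFAStr C F) : Prop :=
  ∀ {U V : C} (f : U ⟶ V),
    (∀ x y : F U, Function.Bijective fun T : x ⟶ y => (P.prod (.single f)).map fun _ => T) ∧
    ∀ y : F V, ∃ (x : F U) (t : (P.prod (.single f)).obj (fun _ => x) ⟶ y),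
      IsUnitaryMor (A := (F V).cat) t

/-- Prefactorization algebras over `C` with values in strict monoidal `C*`-categories. -/
structure PFA (C : OrthCat.{v, u}) where
  obj : C → MonCStarCat.{v', u'}
  str : PFAStr C obj

namespace PFA

variable {C : OrthCat.{v, u}}

/-- Morphisms of prefactorization algebras. -/
@[ext]
structure Hom (F K : PFA.{v, u, v', u'} C) where
  app : ∀ U : C, MonStarFunctor (F.obj U) (K.obj U)
  prod_obj : ∀ {n : ℕ} {U : Fin n → C} {V : C} (f : C.Op U V) (x : ∀ i, F.obj (U i)),
    (app V).obj ((F.str.prod f).obj x) = (K.str.prod f).obj (fun i => (app (U i)).obj (x i))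
  prod_map : ∀ {n : ℕ} {U : Fin n → C} {V : C} (f : C.Op U V) {x y : ∀ i, F.obj (U i)}
    (T : ∀ i, x i ⟶ y i),
    HEq ((app V).map ((F.str.prod f).map T)) ((K.str.prod f).map (fun i => (app (U i)).map (T i)))

/-- The category of prefactorization algebras. -/
instance : Category (PFA.{v, u, v', u'} C) where
  Hom := Hom
  id F := ⟨fun U => .id _, fun {_ _ _} _ _ => rfl,
    fun {_ _ _} _ {_ _} _ => HEq.rfl⟩
  comp {F K L} ζ ξ := ⟨fun U => (ζ.app U).comp (ξ.app U),
    fun {n U V} f x => (congrArg (ξ.app V).obj (ζ.prod_obj f x)).trans (ξ.prod_obj f _),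
    fun {n U V} f {x y} T =>
      (functor_map_heq (ξ.app V).toFunctor (ζ.prod_obj f x) (ζ.prod_obj f y)
        (ζ.prod_map f T)).trans (ξ.prod_map f _)⟩

/-- Pullback of a prefactorization algebra structure along an orthogonal functor. -/
def pullbackObj {D : OrthCat.{v, u}} (α : C ⟶ D) (F : PFA.{v, u, v', u'} D) :
    PFA.{v, u, v', u'} C where
  obj U := F.obj (α.functor.obj U)
  str :=
    { prod := fun f => F.str.prod (f.mapHom α)
      id_obj := fun V x => by
        have h : (OrthCat.Op.single (𝟙 V)).mapHom α = .single (𝟙 (α.functor.obj V)) :=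
          Subtype.ext (funext fun _ => α.functor.map_id V)
        rw [h]; exact F.str.id_obj _ x
      id_map := fun V {x y} T => by
        have h : (OrthCat.Op.single (𝟙 V)).mapHom α = .single (𝟙 (α.functor.obj V)) :=
          Subtype.ext (funext fun _ => α.functor.map_id V)
        rw [h]; exact F.str.id_map _ T
      comp_obj := fun {n U V} f {k W} g x => by
        have h : (f.comp g).mapHom α = (f.mapHom α).comp (fun i => (g i).mapHom α) :=
          Subtype.ext (funext fun _ => α.functor.map_comp _ _)
        rw [h]; exact F.str.comp_obj (f.mapHom α) (fun i => (g i).mapHom α) x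
      comp_map := fun {n U V} f {k W} g {x y} T => by
        have h : (f.comp g).mapHom α = (f.mapHom α).comp (fun i => (g i).mapHom α) :=
          Subtype.ext (funext fun _ => α.functor.map_comp _ _)
        rw [h]; exact F.str.comp_map (f.mapHom α) (fun i => (g i).mapHom α) T
      perm_obj := fun f σ x => F.str.perm_obj (f.mapHom α) σ x
      perm_map := fun {_ _ _} f σ {x y} T => F.str.perm_map (f.mapHom α) σ T }

/-- The pullback functor along an orthogonal functor. -/
def pullback {D : OrthCat.{v, u}} (α : C ⟶ D) :
    PFA.{v, u, v', u'} D ⥤ PFA.{v, u, v', u'} C where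
  obj := pullbackObj α
  map {F K} ζ := ⟨fun U => (ζ.app (α.functor.obj U) :),
    fun {_ _ _} f x => ζ.prod_obj (f.mapHom α) x,
    fun {_ _ _} f {_ _} T => ζ.prod_map (f.mapHom α) T⟩

end PFA

/-- The assignment to `C` of its category of prefactorization algebras. -/
def pfaFunctor : OrthCat.{v, u}ᵒᵖ ⥤ Cat where
  obj C := Cat.of (PFA.{v, u, v', u'} C.unop)
  map α := (PFA.pullback.{v, u, v', u'} α.unop).toCatHom
  map_id _ := rfl
  map_comp _ _ := rfl

/-! ### Equivariance under a discrete group -/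

section Equivariance

variable {G : Type u₁} [Group G]

/-- The orthogonal category underlying an orthogonal category with `G`-action, i.e. a functor from
the one-object groupoid `BG` to orthogonal categories. -/
abbrev orthBase (X : SingleObj G ⥤ OrthCat.{v, u}) : OrthCat.{v, u} := X.obj (SingleObj.star G)

/-- The orthogonal functor `α_g` of an orthogonal category with `G`-action. -/
abbrev orthAct (X : SingleObj G ⥤ OrthCat.{v, u}) (g : G) : orthBase X ⟶ orthBase X :=
  X.map (X := SingleObj.star G) (Y := SingleObj.star G) g

/-- `g ∈ G` as a morphism of `(BG)ᵒᵖ`. -/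
abbrev opHom (g : G) : op (SingleObj.star G) ⟶ op (SingleObj.star G) :=
  Quiver.Hom.op (V := SingleObj G) (X := SingleObj.star G) (Y := SingleObj.star G) g

/-- `G`-equivariant AQFTs: the bicategorical limit of `(BG)ᵒᵖ ⟶ CAT`, `C ↦ AQFT(C)`. -/
abbrev EquivariantAQFT (X : SingleObj G ⥤ OrthCat.{v, u}) :=
  Bilim (X.op ⋙ aqftFunctor.{w, v, u})

/-- `G`-equivariant prefactorization algebras: the bicategorical limit of `(BG)ᵒᵖ ⟶ CAT`,
`C ↦ PFA(C)`. -/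
abbrev EquivariantPFA (X : SingleObj G ⥤ OrthCat.{v, u}) :=
  Bilim (X.op ⋙ pfaFunctor.{v, u, v', u'})

/-- `G`-equivariance structures on a prefactorization algebra `P`: the data which turn `P` into an
object of the category of `G`-equivariant prefactorization algebras. -/
abbrev EquivarianceStr (X : SingleObj G ⥤ OrthCat.{v, u})
    (P : PFA.{v, u, v', u'} (orthBase X)) :=
  BilimStr (X.op ⋙ pfaFunctor.{v, u, v', u'}) (fun _ => P)

/-- The `G`-equivariant prefactorization algebra given by an equivariance structure. -/
abbrev EquivarianceStr.toEquivariantPFA {X : SingleObj G ⥤ OrthCat.{v, u}}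
    {P : PFA.{v, u, v', u'} (orthBase X)} (Ψ : EquivarianceStr X P) :
    EquivariantPFA.{v, u, v', u'} X :=
  ⟨fun _ => P, Ψ⟩

/-- The isomorphism `P ≅ α_g^* P` of an equivariance structure. -/
def EquivarianceStr.act {X : SingleObj G ⥤ OrthCat.{v, u}}
    {P : PFA.{v, u, v', u'} (orthBase X)} (Ψ : EquivarianceStr X P) (g : G) :
    P ≅ (PFA.pullback (orthAct X g)).obj P :=
  Ψ.iso (opHom g)

namespace EquivariantAQFT

variable {X : SingleObj G ⥤ OrthCat.{v, u}} (A : EquivariantAQFT.{w} X)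

/-- The underlying AQFT. -/
def toAQFT : AQFT.{w} (orthBase X) := A.obj (op (SingleObj.star G))

/-- The isomorphism `Ψ_g : 𝔄 ≅ α_g^* 𝔄`. -/
noncomputable def act (g : G) : A.toAQFT ≅ (AQFT.pullback (orthAct X g)).obj A.toAQFT :=
  A.str.iso (opHom g)

/-- The cocone `ι_{α_g U} ∘ (Ψ_g)_U : 𝔄(U) ⟶ 𝔄_⋆` induced by a cocone `ι_U : 𝔄(U) ⟶ 𝔄_⋆`. -/
noncomputable def actCocone (c : Limits.Cocone A.toAQFT.obj) (g : G) :
    Limits.Cocone A.toAQFT.obj :=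
  (Limits.Cocone.precompose
    (show A.toAQFT.obj ⟶ (orthAct X g).functor ⋙ A.toAQFT.obj from (A.act g).hom.hom)).obj
      (c.whisker (orthAct X g).functor)

/-- The endomorphism `Ψ_{⋆ g}` of the universal `C*`-algebra `𝔄_⋆ = colim 𝔄`. -/
noncomputable def universalAct {c : Limits.Cocone A.toAQFT.obj} (hc : Limits.IsColimit c) (g : G) :
    c.pt ⟶ c.pt :=
  hc.desc (A.actCocone c g)

/-- The characterizing property of `Ψ_{⋆ g}`. -/
theorem ι_universalAct {c : Limits.Cocone A.toAQFT.obj} (hc : Limits.IsColimit c) (g : G)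
    (U : orthBase X) (a : A.toAQFT.obj.obj U) :
    (A.universalAct hc g).hom ((c.ι.app U).hom a) =
      (c.ι.app ((orthAct X g).functor.obj U)).hom (((A.act g).hom.hom.app U).hom a) :=
  congrArg (fun k : CStarAlgCat.Hom (A.toAQFT.obj.obj U) c.pt => k.hom a) (hc.fac (A.actCocone c g) U)

end EquivariantAQFT

end Equivariance

/-! ### Superselection sectors -/

section Sectors

variable {H : Type u₁} [NormedAddCommGroup H] [InnerProductSpace ℂ H] [CompleteSpace H]

/-- The bicommutant of the image of a `*`-homomorphism. -/
noncomputable def bicommutant {A : Type w} [CStarAlgebra A] (π : A →⋆ₐ[ℂ] (H →L[ℂ] H)) :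
    VonNeumannAlgebra H where
  toStarSubalgebra := StarSubalgebra.centralizer ℂ
    (StarSubalgebra.centralizer ℂ (Set.range π) : Set (H →L[ℂ] H))
  centralizer_centralizer' := by
    show Set.centralizer (Set.centralizer ((StarSubalgebra.centralizer ℂ
      (StarSubalgebra.centralizer ℂ (Set.range π) : Set (H →L[ℂ] H)) :
        StarSubalgebra ℂ (H →L[ℂ] H)) : Set (H →L[ℂ] H))) =
      ((StarSubalgebra.centralizer ℂ
      (StarSubalgebra.centralizer ℂ (Set.range π) : Set (H →L[ℂ] H)) :
        StarSubalgebra ℂ (H →L[ℂ] H)) : Set (H →L[ℂ] H))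
    rw [StarSubalgebra.coe_centralizer_centralizer, Set.centralizer_centralizer_centralizer]

/-- The range of a `*`-homomorphism is closed under the involution, hence `bicommutant` is the
bicommutant in the usual sense. -/
theorem coe_bicommutant {A : Type w} [CStarAlgebra A] (π : A →⋆ₐ[ℂ] (H →L[ℂ] H)) :
    (bicommutant π : Set (H →L[ℂ] H)) = Set.centralizer (Set.centralizer (Set.range π)) := by
  have h : Set.range π ∪ star (Set.range π) = Set.range π := by
    refine Set.union_eq_left.mpr ?_
    rintro x ⟨a, ha⟩
    exact ⟨star a, by rw [map_star, ha, star_star]⟩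
  show ((StarSubalgebra.centralizer ℂ
      (StarSubalgebra.centralizer ℂ (Set.range π) : Set (H →L[ℂ] H)) :
        StarSubalgebra ℂ (H →L[ℂ] H)) : Set (H →L[ℂ] H)) = _
  rw [StarSubalgebra.coe_centralizer_centralizer, h]

variable (H) in
/-- Isotonous nets of von Neumann algebras on `H`, indexed by the objects of a category. -/
structure VNNet (C : OrthCat.{v, u}) where
  alg : C → VonNeumannAlgebra H
  mono : ∀ {U V : C}, (U ⟶ V) → ∀ {T : H →L[ℂ] H}, T ∈ alg U → T ∈ alg V

/-- The local representation `π_U = π ∘ ι_U` of `𝔄(U)` given by a representation `π` of the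
universal algebra. -/
noncomputable def localRep {C : OrthCat.{v, u}} {F : C ⥤ CStarAlgCat.{w}} {c : Limits.Cocone F}
    (π : c.pt →⋆ₐ[ℂ] (H →L[ℂ] H)) (U : C) : F.obj U →⋆ₐ[ℂ] (H →L[ℂ] H) :=
  π.comp (c.ι.app U).hom

theorem localRep_map {C : OrthCat.{v, u}} {F : C ⥤ CStarAlgCat.{w}} {c : Limits.Cocone F}
    (π : c.pt →⋆ₐ[ℂ] (H →L[ℂ] H)) {U V : C} (f : U ⟶ V) (a : F.obj U) :
    localRep π V ((F.map f).hom a) = localRep π U a := by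
  have h : F.map f ≫ c.ι.app V = c.ι.app U := c.w f
  exact congrArg π (congrArg (fun k : CStarAlgCat.Hom (F.obj U) c.pt => k.hom a) h)

/-- The net `π₀(𝔄)''` of bicommutants `U ↦ π₀_U(𝔄(U))''`. -/
noncomputable def bicommutantNet {C : OrthCat.{v, u}} {F : C ⥤ CStarAlgCat.{w}}
    {c : Limits.Cocone F} (π : c.pt →⋆ₐ[ℂ] (H →L[ℂ] H)) : VNNet H C where
  alg U := bicommutant (localRep π U)
  mono {U V} f T hT := by
    rw [← SetLike.mem_coe, coe_bicommutant] at hT ⊢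
    refine Set.centralizer_subset (Set.centralizer_subset ?_) hT
    rintro _ ⟨a, rfl⟩
    exact ⟨_, localRep_map π f a⟩

namespace VNNet

variable {C : OrthCat.{v, u}} (R : VNNet H C)

/-- The universal `C*`-algebra `R_⋆` of a net of von Neumann algebras on `H`: the colimit of the
`R(U)` along the inclusions, realized on `H` as the norm closure of the algebra they generate. -/
noncomputable def universal : StarSubalgebra ℂ (H →L[ℂ] H) :=
  (⨆ U, (R.alg U).toStarSubalgebra).topologicalClosure

theorem mem_universal {U : C} {T : H →L[ℂ] H} (hT : T ∈ R.alg U) : T ∈ R.universal :=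
  StarSubalgebra.le_topologicalClosure _
    ((le_iSup (fun U => (R.alg U).toStarSubalgebra) U : _) hT)

/-- Strictly `U`-localized superselection sectors, as `*`-endomorphisms of the universal algebra. -/
@[ext]
structure Sector (U : C) where
  toHom : R.universal →⋆ₐ[ℂ] R.universal
  /-- localizability in every object `W` of `C` -/
  localizable : ∀ W : C, ∃ v : unitary (H →L[ℂ] H),
    ∀ {W' V : C} (f' : W' ⟶ V) (f : W ⟶ V), C.Perp f' f →
      ∀ a : R.universal, (a : H →L[ℂ] H) ∈ R.alg W' →
        (v : H →L[ℂ] H) * (toHom a : H →L[ℂ] H) = (a : H →L[ℂ] H) * (v : H →L[ℂ] H)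
  /-- strict localization in `U` -/
  localized : ∀ {U' V : C} (f' : U' ⟶ V) (f : U ⟶ V), C.Perp f' f →
      ∀ a : R.universal, (a : H →L[ℂ] H) ∈ R.alg U' → toHom a = a

variable {R}

namespace Sector

variable {U : C}

/-- The space of morphisms `ρ ⟶ σ` of sectors: elements `T ∈ R(U)` with `T ρ(a) = σ(a) T`. -/
def homSubmodule (ρ σ : R.Sector U) : Submodule ℂ (H →L[ℂ] H) where
  carrier := {T | T ∈ R.alg U ∧ ∀ a : R.universal,
    T * (ρ.toHom a : H →L[ℂ] H) = (σ.toHom a : H →L[ℂ] H) * T}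
  zero_mem' := ⟨zero_mem _, fun a => by simp⟩
  add_mem' := fun hS hT => ⟨add_mem hS.1 hT.1, fun a => by
    rw [add_mul, mul_add, hS.2 a, hT.2 a]⟩
  smul_mem' := fun z T hT => ⟨(R.alg U).toStarSubalgebra.smul_mem hT.1 z, fun a => by
    rw [smul_mul_assoc, mul_smul_comm, hT.2 a]⟩

theorem isClosed_alg (V : VonNeumannAlgebra H) : IsClosed (V : Set (H →L[ℂ] H)) := by
  rw [← V.centralizer_centralizer]
  exact Set.isClosed_centralizer _

theorem isClosed_homSubmodule (ρ σ : R.Sector U) :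
    IsClosed (homSubmodule ρ σ : Set (H →L[ℂ] H)) := by
  have h : (homSubmodule ρ σ : Set (H →L[ℂ] H)) = (R.alg U : Set (H →L[ℂ] H)) ∩
      ⋂ a : R.universal, {T | T * (ρ.toHom a : H →L[ℂ] H) = (σ.toHom a : H →L[ℂ] H) * T} := by
    ext T
    simp [homSubmodule]
  rw [h]
  exact (isClosed_alg _).inter (isClosed_iInter fun a => isClosed_eq (by fun_prop) (by fun_prop))

/-- The category of strictly `U`-localized sectors; composition is composition of operators. -/
noncomputable instance : Category (R.Sector U) where
  Hom ρ σ := homSubmodule ρ σ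
  id ρ := ⟨1, one_mem _, fun a => by simp⟩
  comp {ρ σ τ} S T := ⟨T.1 * S.1, mul_mem T.2.1 S.2.1, fun a => by
    rw [mul_assoc, S.2.2 a, ← mul_assoc, T.2.2 a, mul_assoc]⟩
  id_comp T := Subtype.ext (mul_one _)
  comp_id T := Subtype.ext (one_mul _)
  assoc S T K := Subtype.ext (mul_assoc _ _ _).symm

/-- The operator underlying a morphism of sectors. -/
def op {ρ σ : R.Sector U} (T : ρ ⟶ σ) : H →L[ℂ] H := T.1

/-- The operator underlying a morphism of sectors, as an element of the universal algebra. -/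
def opUniversal {ρ σ : R.Sector U} (T : ρ ⟶ σ) : R.universal := ⟨T.1, R.mem_universal T.2.1⟩

noncomputable instance (ρ σ : R.Sector U) : NormedAddCommGroup (ρ ⟶ σ) :=
  inferInstanceAs (NormedAddCommGroup (homSubmodule ρ σ))

noncomputable instance (ρ σ : R.Sector U) : NormedSpace ℂ (ρ ⟶ σ) :=
  inferInstanceAs (NormedSpace ℂ (homSubmodule ρ σ))

instance (ρ σ : R.Sector U) : CompleteSpace (ρ ⟶ σ) :=
  (isClosed_homSubmodule ρ σ).completeSpace_coe

theorem dagger_mem {ρ σ : R.Sector U} {T : H →L[ℂ] H} (hT : T ∈ homSubmodule ρ σ) :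
    star T ∈ homSubmodule σ ρ := by
  refine ⟨star_mem hT.1, fun a => ?_⟩
  have h := congrArg star (hT.2 (star a))
  rw [star_mul, star_mul, map_star, map_star] at h
  simpa using h.symm

theorem sqrt_mem {ρ : R.Sector U} {T : H →L[ℂ] H} (hT : T ∈ homSubmodule ρ ρ) (h0 : 0 ≤ T) :
    CFC.sqrt T ∈ homSubmodule ρ ρ := by
  let S : StarSubalgebra ℂ (H →L[ℂ] H) :=
    { carrier := homSubmodule ρ ρ
      mul_mem' := fun {S T} hS hT => ⟨mul_mem hS.1 hT.1, fun a => by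
        rw [mul_assoc, hT.2 a, ← mul_assoc, hS.2 a, mul_assoc]⟩
      add_mem' := fun hS hT => add_mem hS hT
      algebraMap_mem' := fun z => by
        rw [Algebra.algebraMap_eq_smul_one]
        exact Submodule.smul_mem _ z ⟨one_mem _, fun a => by simp⟩
      star_mem' := fun hT => dagger_mem hT }
  have : IsClosed (S : Set (H →L[ℂ] H)) := isClosed_homSubmodule ρ ρ
  rw [CFC.sqrt_eq_real_sqrt T h0, cfcₙ_eq_cfc]
  exact cfc_mem (𝕜' := ℂ) (s := S) Real.sqrt hT

/-- The `C*`-structure: norm and adjoint of bounded operators. -/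
noncomputable instance : CStarCategory (R.Sector U) where
  add_comp S S' T := Subtype.ext (mul_add _ _ _)
  comp_add S T T' := Subtype.ext (add_mul _ _ _)
  smul_comp z S T := Subtype.ext (mul_smul_comm _ _ _)
  comp_smul z S T := Subtype.ext (smul_mul_assoc _ _ _)
  norm_comp_le S T := (norm_mul_le T.1 S.1).trans_eq (mul_comm _ _)
  dagger T := ⟨star T.1, dagger_mem T.2⟩
  dagger_add S T := Subtype.ext (star_add S.1 T.1)
  dagger_smul z T := Subtype.ext (star_smul z T.1)
  dagger_dagger T := Subtype.ext (star_star T.1)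
  dagger_comp S T := Subtype.ext (star_mul T.1 S.1)
  norm_comp_dagger T := CStarRing.norm_star_mul_self (x := T.1)
  positive {ρ σ} T := by
    have hT : star T.1 * T.1 ∈ homSubmodule ρ ρ :=
      ⟨mul_mem (star_mem T.2.1) T.2.1, fun a => by
        rw [mul_assoc, T.2.2 a, ← mul_assoc, (dagger_mem T.2).2 a, mul_assoc]⟩
    have h0 : (0 : H →L[ℂ] H) ≤ star T.1 * T.1 := star_mul_self_nonneg _
    refine ⟨⟨CFC.sqrt (star T.1 * T.1), sqrt_mem hT h0⟩, Subtype.ext ?_⟩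
    show star T.1 * T.1 = star (CFC.sqrt (star T.1 * T.1)) * CFC.sqrt (star T.1 * T.1)
    rw [(IsSelfAdjoint.of_nonneg (CFC.sqrt_nonneg (star T.1 * T.1))).star_eq, CFC.sqrt_mul_sqrt_self _ h0]

/-- The inclusion of the `U`-localized sectors into the `V`-localized sectors, for `f : U ⟶ V`. -/
def incl {V : C} (f : U ⟶ V) (ρ : R.Sector U) : R.Sector V where
  toHom := ρ.toHom
  localizable := ρ.localizable
  localized f' h hp a ha := ρ.localized f' (f ≫ h)
    (by simpa [OrthCat.Perp] using C.orth.precomp (𝟙 _) f hp) a ha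

/-- The inclusion on morphisms. -/
def inclHom {V : C} (f : U ⟶ V) {ρ σ : R.Sector U} (T : ρ ⟶ σ) : incl f ρ ⟶ incl f σ :=
  ⟨T.1, R.mono f T.2.1, T.2.2⟩

end Sector

variable (R)

/-- The `C*`-category of strictly `U`-localized superselection sectors. -/
noncomputable def sss (U : C) : CStarCat.{u₁, u₁} := ⟨R.Sector U⟩

end VNNet

/-! ### Projective unitary representations -/

variable (H) in
/-- The unitary scalars. -/
def unitaryScalars : Subgroup (unitary (H →L[ℂ] H)) where
  carrier := {v | ∃ z : ℂ, (v : H →L[ℂ] H) = z • 1}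
  one_mem' := ⟨1, by simp⟩
  mul_mem' := by
    rintro a b ⟨z, hz⟩ ⟨y, hy⟩
    exact ⟨z * y, by simp [hz, hy, smul_smul, mul_comm]⟩
  inv_mem' := by
    rintro a ⟨z, hz⟩
    exact ⟨star z, by rw [← Unitary.star_eq_inv, Unitary.coe_star, hz, star_smul, star_one]⟩

instance : (unitaryScalars H).Normal where
  conj_mem := by
    rintro v ⟨z, hz⟩ w
    refine ⟨z, ?_⟩
    have : w * v * w⁻¹ = v := by
      rw [mul_inv_eq_iff_eq_mul]
      ext1
      simp [hz]
    rw [this, hz]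

variable (H) in
/-- The projective unitary group `PU(H)`. -/
abbrev ProjUnitary := unitary (H →L[ℂ] H) ⧸ unitaryScalars H

/-- The adjoint action `Ad_u(T) = u T u*` of the projective unitary group on `B(H)`. -/
noncomputable def Ad : ProjUnitary H →* ((H →L[ℂ] H) ≃⋆ₐ[ℂ] (H →L[ℂ] H)) :=
  QuotientGroup.lift (unitaryScalars H) (Unitary.conjStarAlgAut ℂ (H →L[ℂ] H)) (by
    rintro v ⟨z, hz⟩
    ext1 T
    have h : (v : H →L[ℂ] H) * star (v : H →L[ℂ] H) = 1 := Unitary.mul_star_self_of_mem v.2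
    have h' : (v : H →L[ℂ] H) * T = T * v := by rw [hz]; simp
    show (v : H →L[ℂ] H) * T * star (v : H →L[ℂ] H) = T
    rw [h', mul_assoc, h, mul_one])

end Sectors

/-! This is the Doplicher–Haag–Roberts argument over an orthogonal category. Haag duality turns
commutation into localization: an operator that commutes with every local algebra orthogonal to U
lies in R(U). Hence a U-localized endomorphism preserves R(U) (`toHom_mem`), intertwiners of
U-localized sectors lie in R(U) (`hom_mem`), and a unitary moving a sector from U to W lies in R(Z)
whenever U and W both map to Z (`transporter_mem`). Filteredness supplies such a Z, so transporters
belong to R_⋆ and endomorphisms can be applied to them; this makes products of sectors localizable.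
Local constancy follows too: conjugation with a transporter relocates a sector, and `hom_mem` gives
fullness of the inclusions.

The decisive point is that sectors with orthogonal localization commute (`commute_toHom`). Both are
moved away from a given observable into separated regions; on that observable they are implemented
by their transporters, which commute and are each fixed by the other endomorphism. On morphisms, the
twist in T ρ(S) disappears because ρ fixes the algebras orthogonal to its localization
(`opUniversal_tensorPowHom`). A factorization product is therefore an ordered product of commuting
endomorphisms, or of commuting operators, and the prefactorization axioms become rearrangements:
permutation, regrouping and interchange.

For equivariance, Ad_{u_g} implements Ψ on the local algebras and so carries R(U) into R(gU), by
passage to bicommutants (`isCovariant_bicommutantNet`). Conjugation by it is a homomorphism of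
endomorphism monoids, hence respects all products; scalar phases cancel in Ad, so a projective
representation gives strict coherence. -/

/-! ### Ordered products of commuting families -/

section OrderedProducts

variable {N : Type w} [Monoid N]

/-- A family of pairwise commuting elements comes from a commutative monoid. -/
theorem exists_commMonoid_lift {ι : Type*} (x : ι → N) (hx : ∀ i j, i ≠ j → Commute (x i) (x j)) :
    ∃ (N' : Type w) (_ : CommMonoid N') (φ : N' →* N) (y : ι → N'), ∀ i, φ (y i) = x i := by
  have h : ∀ a ∈ Set.range x, ∀ b ∈ Set.range x, a * b = b * a := by
    rintro _ ⟨i, rfl⟩ _ ⟨j, rfl⟩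
    by_cases hij : i = j
    · rw [hij]
    · exact hx i j hij
  have := Submonoid.isMulCommutative_closure _ h
  exact ⟨Submonoid.closure (Set.range x),
    { (inferInstance : Monoid (Submonoid.closure (Set.range x))) with
      mul_comm := fun a b => this.is_comm.comm a b },
    (Submonoid.closure (Set.range x)).subtype,
    fun i => ⟨x i, Submonoid.subset_closure ⟨i, rfl⟩⟩, fun i => rfl⟩

/-- In the commutative monoid of the lift the list product is a finite product, which can be
reindexed. Serves permutation equivariance, for endomorphisms and for operators alike. -/
theorem prod_ofFn_perm {n : ℕ} (x : Fin n → N) (hx : ∀ i j, i ≠ j → Commute (x i) (x j))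
    (σ : Equiv.Perm (Fin n)) :
    (List.ofFn fun i => x (σ i)).prod = (List.ofFn x).prod := by
  obtain ⟨N', _, φ, y, hy⟩ := exists_commMonoid_lift x hx
  obtain rfl : (fun i => φ (y i)) = x := funext hy
  have h (z : Fin n → N') : (List.ofFn fun i => φ (z i)).prod = φ (∏ i, z i) := by
    rw [← Fin.prod_ofFn, map_list_prod, List.map_ofFn]
    rfl
  rw [h, h, Equiv.prod_comp σ y]

/-- This is operadic associativity on the level of products. The lexicographic enumeration is
irrelevant, since entries commute both within a block and across blocks. -/
theorem prod_ofFn_finSigma {n : ℕ} {k : Fin n → ℕ} (x : ∀ i, Fin (k i) → N)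
    (hx : ∀ p q : (i : Fin n) × Fin (k i), p ≠ q → Commute (x p.1 p.2) (x q.1 q.2)) :
    (List.ofFn fun j : Fin (∑ i, k i) =>
        x (finSigmaFinEquiv.symm j).1 (finSigmaFinEquiv.symm j).2).prod =
      (List.ofFn fun i => (List.ofFn (x i)).prod).prod := by
  obtain ⟨N', _, φ, y, hy⟩ := exists_commMonoid_lift
    (fun p : (i : Fin n) × Fin (k i) => x p.1 p.2) hx
  obtain rfl : (fun i l => φ (y ⟨i, l⟩)) = x := funext₂ fun i l => hy ⟨i, l⟩
  have h (m : ℕ) (z : Fin m → N') : (List.ofFn fun i => φ (z i)).prod = φ (∏ i, z i) := by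
    rw [← Fin.prod_ofFn, map_list_prod, List.map_ofFn]
    rfl
  simp only [h]
  rw [Equiv.prod_comp finSigmaFinEquiv.symm fun p => y ⟨p.1, p.2⟩, Fintype.prod_sigma]

theorem commute_prod_ofFn {n : ℕ} {a : N} {x : Fin n → N} (h : ∀ i, Commute a (x i)) :
    Commute a (List.ofFn x).prod := by
  refine Commute.list_prod_right _ _ fun b hb => ?_
  obtain ⟨i, rfl⟩ := List.mem_ofFn.mp hb
  exact h i

/-- Interchange law: the factor `y 0` has to pass only those `x i` with i ≠ 0, so nothing is
required of `x i` and `y i` at the same index, nor inside either family. -/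
theorem prod_ofFn_mul : ∀ {n : ℕ} (x y : Fin n → N), (∀ i j, i ≠ j → Commute (x i) (y j)) →
    (List.ofFn fun i => x i * y i).prod = (List.ofFn x).prod * (List.ofFn y).prod
  | 0, _, _, _ => by simp
  | n + 1, x, y, h => by
    have hc : Commute (y 0) (List.ofFn fun i : Fin n => x i.succ).prod :=
      commute_prod_ofFn fun i => (h i.succ 0 (Fin.succ_ne_zero i)).symm
    simp only [List.ofFn_succ, List.prod_cons]
    rw [prod_ofFn_mul (fun i => x i.succ) (fun i => y i.succ)
      fun i j hij => h _ _ ((Fin.succ_injective n).ne hij)]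
    rw [mul_assoc, mul_assoc, ← mul_assoc (y 0), hc.eq, mul_assoc]

end OrderedProducts

/-! ### Orthogonal cospans and separation of regions. -/

namespace OrthCat

variable {C : OrthCat.{v, u}}

theorem Perp.symm {U₁ U₂ V : C} {f₁ : U₁ ⟶ V} {f₂ : U₂ ⟶ V} (h : C.Perp f₁ f₂) : C.Perp f₂ f₁ :=
  C.orth.symm h

theorem Perp.postcomp {U₁ U₂ V V' : C} {f₁ : U₁ ⟶ V} {f₂ : U₂ ⟶ V} (h : C.Perp f₁ f₂)
    (k : V ⟶ V') : C.Perp (f₁ ≫ k) (f₂ ≫ k) :=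
  C.orth.postcomp k h

theorem Perp.precomp_right {W U₁ U₂ V : C} {f₁ : U₁ ⟶ V} {f₂ : U₂ ⟶ V} (h : C.Perp f₁ f₂)
    (k : W ⟶ U₂) : C.Perp f₁ (k ≫ f₂) := by
  simpa [Perp] using C.orth.precomp (𝟙 _) k h

variable (C) in
/-- The geometric assumption: for every orthogonal cospan, the two sources can be transported out
of the target to causally separated regions. -/
def HasSeparatedTransport : Prop :=
  ∀ (U₁ U₂ U : C) (f₁ : U₁ ⟶ U) (f₂ : U₂ ⟶ U), C.Perp f₁ f₂ →
    ∃ (W V₁ V₂ U₁' U₂' : C) (k : U ⟶ W) (k₁ : V₁ ⟶ W) (k₂ : V₂ ⟶ W)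
      (j₁ : U₁ ⟶ V₁) (j₁' : U₁' ⟶ V₁) (j₂ : U₂ ⟶ V₂) (j₂' : U₂' ⟶ V₂),
      C.Perp k₁ k₂ ∧ C.Perp j₁' j₁ ∧ C.Perp j₂ j₂' ∧
      C.Perp (j₁' ≫ k₁) k ∧ C.Perp (j₂' ≫ k₂) k

end OrthCat

/-! ### The universal algebra and Haag duality. -/

namespace VNNet

variable {H : Type u₁} [NormedAddCommGroup H] [InnerProductSpace ℂ H] [CompleteSpace H]
variable {C : OrthCat.{v, u}} {R : VNNet H C}

instance isClosed_universal : IsClosed (R.universal : Set (H →L[ℂ] H)) :=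
  StarSubalgebra.isClosed_topologicalClosure _

noncomputable instance : CStarAlgebra R.universal := StarSubalgebra.cstarAlgebra R.universal

theorem continuous_hom (φ : R.universal →⋆ₐ[ℂ] R.universal) : Continuous φ :=
  AddMonoidHomClass.continuous_of_bound φ 1 fun a => by
    simpa only [one_mul] using NonUnitalStarAlgHom.norm_apply_le φ a

/-- `*`-endomorphisms of the universal algebra are determined by their restrictions to the local
algebras. -/
theorem hom_ext {φ ψ : R.universal →⋆ₐ[ℂ] R.universal}
    (h : ∀ (U : C) (a : R.universal), (a : H →L[ℂ] H) ∈ R.alg U → φ a = ψ a) : φ = ψ := by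
  -- The equalizer is moved into B(H), where the universal algebra is a topological closure; it is
  -- closed because `*`-homomorphisms are continuous, and it contains the generating local algebras.
  let S : StarSubalgebra ℂ (H →L[ℂ] H) := (StarAlgHom.equalizer φ ψ).map R.universal.subtype
  have hS : IsClosed (S : Set (H →L[ℂ] H)) := by
    have h1 : IsClosed {a | φ a = ψ a} :=
      isClosed_eq (continuous_hom φ) (continuous_hom ψ)
    exact (isClosed_universal (R := R)).isClosedEmbedding_subtypeVal.isClosedMap _ h1
  have hle : R.universal ≤ S := by
    refine StarSubalgebra.topologicalClosure_minimal (iSup_le fun U T hT => ?_) hS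
    exact ⟨⟨T, R.mem_universal hT⟩, h U _ hT, rfl⟩
  refine StarAlgHom.ext fun a => ?_
  obtain ⟨b, hb, hba⟩ := hle a.2
  obtain rfl : b = a := Subtype.ext hba
  exact hb

/-- Causality and Haag duality of a net of von Neumann algebras. -/
structure IsHaagDual (R : VNNet H C) : Prop where
  commute : ∀ {U₁ U₂ V : C} {f₁ : U₁ ⟶ V} {f₂ : U₂ ⟶ V}, C.Perp f₁ f₂ →
    ∀ {S T : H →L[ℂ] H}, S ∈ R.alg U₁ → T ∈ R.alg U₂ → Commute S T
  mem : ∀ {U : C} {T : H →L[ℂ] H}, (∀ {U' V : C} (f' : U' ⟶ V) (f : U ⟶ V), C.Perp f' f →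
    ∀ S ∈ R.alg U', Commute T S) → T ∈ R.alg U

/-! ### Localized endomorphisms, transporters and products. -/

namespace Sector

variable {U V : C}

theorem ext_hom {ρ σ : R.Sector U} {T S : ρ ⟶ σ} (h : T.1 = S.1) : T = S := Subtype.ext h

/-- Sectors are determined by their endomorphisms, so agreement of those identifies the morphism
spaces. Heterogeneous equalities of factorization products thus become equalities of operators. -/
theorem heq_of_op_eq {ρ σ ρ' σ' : R.Sector U} (hρ : ρ.toHom = ρ'.toHom) (hσ : σ.toHom = σ'.toHom)
    {T : ρ ⟶ σ} {S : ρ' ⟶ σ'} (h : T.1 = S.1) : HEq T S := by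
  obtain rfl := Sector.ext hρ
  obtain rfl := Sector.ext hσ
  exact heq_of_eq (ext_hom h)

/-- A localized endomorphism acts trivially on the local algebras orthogonal to its localization
region. -/
theorem toHom_eq_self (ρ : R.Sector U) {U' : C} {f' : U' ⟶ V} {f : U ⟶ V} (h : C.Perp f' f)
    {a : R.universal} (ha : (a : H →L[ℂ] H) ∈ R.alg U') : ρ.toHom a = a :=
  ρ.localized f' f h a ha

/-- An element of R(U) commutes with the algebras orthogonal to U; ρ fixes those algebras, so the
image commutes with them as well and duality applies. -/
theorem toHom_mem (hR : R.IsHaagDual) (ρ : R.Sector U) {a : R.universal}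
    (ha : (a : H →L[ℂ] H) ∈ R.alg U) : (ρ.toHom a : H →L[ℂ] H) ∈ R.alg U := by
  refine hR.mem fun f' f hp S hS => ?_
  have h1 : a * ⟨S, R.mem_universal hS⟩ = ⟨S, R.mem_universal hS⟩ * a :=
    Subtype.ext (hR.commute hp.symm ha hS)
  have h2 := congrArg ρ.toHom h1
  rw [map_mul, map_mul, ρ.toHom_eq_self (a := ⟨S, R.mem_universal hS⟩) hp hS] at h2
  exact congrArg Subtype.val h2

/-- Unitaries which transport a sector localized in `U` to `W` are contained in the local algebra
of any object receiving morphisms from `U` and `W`. -/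
theorem transporter_mem (hR : R.IsHaagDual) (ρ : R.Sector U) {W Z : C} (f : U ⟶ Z) (g : W ⟶ Z)
    {v : H →L[ℂ] H}
    (hv : ∀ {W' V : C} (f' : W' ⟶ V) (f : W ⟶ V), C.Perp f' f →
      ∀ a : R.universal, (a : H →L[ℂ] H) ∈ R.alg W' → v * (ρ.toHom a : H →L[ℂ] H) = a * v) :
    v ∈ R.alg Z := by
  refine hR.mem fun f' k hp S hS => ?_
  -- A region orthogonal to Z is orthogonal to both U and W: there ρ is trivial and v intertwines it
  -- with the identity, so v commutes with the algebra of that region.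
  have h := hv f' (g ≫ k) (hp.precomp_right g) ⟨S, R.mem_universal hS⟩ hS
  rwa [ρ.toHom_eq_self (hp.precomp_right f) hS] at h

/-- Both endomorphisms are trivial on algebras orthogonal to U, where the intertwining relation is
plain commutation. Locality of intertwiners is thus automatic, which makes the inclusions of sector
categories full. -/
theorem hom_mem (hR : R.IsHaagDual) {ρ σ : R.Sector U} {T : H →L[ℂ] H}
    (hT : ∀ a : R.universal, T * (ρ.toHom a : H →L[ℂ] H) = (σ.toHom a : H →L[ℂ] H) * T) :
    T ∈ R.alg U := by
  refine hR.mem fun f' f hp S hS => ?_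
  have h := hT ⟨S, R.mem_universal hS⟩
  rwa [ρ.toHom_eq_self hp hS, σ.toHom_eq_self hp hS] at h

/-- A sector is unitarily equivalent to a sector localized in any given region. -/
theorem exists_transport (hR : R.IsHaagDual) (f : U ⟶ V) (ρ : R.Sector V) :
    ∃ (σ : R.Sector U) (t : incl f σ ⟶ ρ), star t.1 * t.1 = 1 ∧ t.1 * star t.1 = 1 := by
  obtain ⟨v, hv⟩ := ρ.localizable U
  -- Both U and V map to V, so the transporter lies in R(V) and conjugation with it preserves R_⋆;
  -- the relocated sector is Ad_v ∘ ρ.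
  have hvV : (v : H →L[ℂ] H) ∈ R.alg V := ρ.transporter_mem hR (𝟙 V) f hv
  let v' : unitary R.universal := ⟨⟨v, R.mem_universal hvV⟩,
    Unitary.mem_iff.mpr ⟨Subtype.ext (Unitary.coe_star_mul_self v),
      Subtype.ext (Unitary.coe_mul_star_self v)⟩⟩
  let φ : R.universal →⋆ₐ[ℂ] R.universal :=
    (Unitary.conjStarAlgAut ℂ R.universal v' : R.universal →⋆ₐ[ℂ] R.universal).comp ρ.toHom
  have hφ (a : R.universal) : (φ a : H →L[ℂ] H) = v * ρ.toHom a * star (v : H →L[ℂ] H) := rfl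
  refine ⟨⟨φ, fun W => ?_, fun f' k hp a ha => Subtype.ext ?_⟩,
    ⟨star (v : H →L[ℂ] H), star_mem hvV, fun a => ?_⟩, ?_, ?_⟩
  · obtain ⟨w, hw⟩ := ρ.localizable W
    -- To reach W, first undo the conjugation with v, then use the transporter of ρ to W.
    refine ⟨w * star v, fun f' k hp a ha => ?_⟩
    rw [hφ]
    simp only [Submonoid.coe_mul, Unitary.coe_star]
    calc (w : H →L[ℂ] H) * star (v : H →L[ℂ] H) * (v * ρ.toHom a * star (v : H →L[ℂ] H))
        = w * (star (v : H →L[ℂ] H) * v) * ρ.toHom a * star (v : H →L[ℂ] H) := by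
          simp only [mul_assoc]
      _ = a * (w * star (v : H →L[ℂ] H)) := by
          rw [Unitary.coe_star_mul_self, mul_one, hw f' k hp a ha, mul_assoc]
  · rw [hφ, hv f' k hp a ha, mul_assoc, Unitary.mul_star_self_of_mem v.2, mul_one]
  · show star (v : H →L[ℂ] H) * (φ a : H →L[ℂ] H) = _
    rw [hφ, ← mul_assoc, ← mul_assoc, Unitary.coe_star_mul_self, one_mul]
  · show star (star (v : H →L[ℂ] H)) * star (v : H →L[ℂ] H) = 1
    rw [star_star, Unitary.mul_star_self_of_mem v.2]
  · show star (v : H →L[ℂ] H) * star (star (v : H →L[ℂ] H)) = 1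
    rw [star_star, Unitary.coe_star_mul_self]

/-- The vacuum sector. -/
noncomputable def one (R : VNNet H C) (U : C) : R.Sector U where
  toHom := StarAlgHom.id ℂ R.universal
  localizable _ := ⟨1, fun _ _ _ a _ => by simp⟩
  localized _ _ _ _ _ := rfl

/-- The product of localized sectors, given by the composition of endomorphisms. -/
noncomputable def mul [IsFiltered C] (hR : R.IsHaagDual) (ρ σ : R.Sector U) : R.Sector U where
  toHom := ρ.toHom.comp σ.toHom
  localizable W := by
    obtain ⟨v, hv⟩ := ρ.localizable W
    obtain ⟨w, hw⟩ := σ.localizable W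
    -- A common target of U and W places w in R_⋆, so that ρ(w) makes sense and v ρ(w) can serve as
    -- the transporter of the product.
    have hwu : (w : H →L[ℂ] H) ∈ R.universal := R.mem_universal
      (σ.transporter_mem hR (IsFiltered.leftToMax U W) (IsFiltered.rightToMax U W) hw)
    let w' : unitary R.universal := ⟨⟨w, hwu⟩, Unitary.mem_iff.mpr
      ⟨Subtype.ext (Unitary.coe_star_mul_self w), Subtype.ext (Unitary.coe_mul_star_self w)⟩⟩
    refine ⟨v * ⟨(ρ.toHom w' : H →L[ℂ] H), Unitary.map_mem (R.universal.subtype.comp ρ.toHom) w'.2⟩,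
      fun f' f hp a ha => ?_⟩
    have h1 : (w' : R.universal) * σ.toHom a = a * w' := Subtype.ext (hw f' f hp a ha)
    have h2 : (ρ.toHom w' : H →L[ℂ] H) * ρ.toHom (σ.toHom a) = ρ.toHom a * ρ.toHom w' := by
      have := congrArg (fun b => (ρ.toHom b : H →L[ℂ] H)) h1
      simpa using this
    show (v : H →L[ℂ] H) * (ρ.toHom w' : H →L[ℂ] H) * ρ.toHom (σ.toHom a) =
      a * (v * (ρ.toHom w' : H →L[ℂ] H))
    rw [mul_assoc, h2, ← mul_assoc, hv f' f hp a ha, mul_assoc]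
  localized f' f hp a ha := by
    show ρ.toHom (σ.toHom a) = a
    rw [σ.toHom_eq_self hp ha, ρ.toHom_eq_self hp ha]

/-- The product of morphisms of sectors. -/
noncomputable def mulHom [IsFiltered C] (hR : R.IsHaagDual) {ρ ρ' σ σ' : R.Sector U} (T : ρ ⟶ ρ')
    (S : σ ⟶ σ') : mul hR ρ σ ⟶ mul hR ρ' σ' :=
  ⟨T.1 * ρ.toHom (opUniversal S), mul_mem T.2.1 (ρ.toHom_mem hR S.2.1), fun a => by
    have h : opUniversal S * σ.toHom a = σ'.toHom a * opUniversal S := Subtype.ext (S.2.2 a)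
    show T.1 * (ρ.toHom (opUniversal S) : H →L[ℂ] H) * ρ.toHom (σ.toHom a) =
      ρ'.toHom (σ'.toHom a) * (T.1 * ρ.toHom (opUniversal S))
    have h' : (ρ.toHom (opUniversal S) : H →L[ℂ] H) * ρ.toHom (σ.toHom a) =
        ρ.toHom (σ'.toHom a) * ρ.toHom (opUniversal S) := by
      simpa using congrArg (fun b => (ρ.toHom b : H →L[ℂ] H)) h
    rw [mul_assoc, h', ← mul_assoc, T.2.2, mul_assoc]⟩

/-- Sectors with orthogonal localization regions commute. -/
theorem commute_toHom [IsFiltered C] (hR : R.IsHaagDual) (hC : C.HasSeparatedTransport) {U₁ U₂ : C}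
    {f₁ : U₁ ⟶ U} {f₂ : U₂ ⟶ U} (hf : C.Perp f₁ f₂) (ρ₁ : R.Sector U₁) (ρ₂ : R.Sector U₂) :
    Commute ρ₁.toHom ρ₂.toHom := by
  refine hom_ext fun Z a ha => ?_
  -- The target is first enlarged to receive Z: the regions U₁' and U₂' are then orthogonal to the
  -- algebra containing a.
  obtain ⟨W, V₁, V₂, U₁', U₂', k, k₁, k₂, j₁, j₁', j₂, j₂', hk, h₁, h₂, hk₁, hk₂⟩ :=
    hC _ _ _ (f₁ ≫ IsFiltered.leftToMax U Z) (f₂ ≫ IsFiltered.leftToMax U Z) (hf.postcomp _)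
  have ha' := R.mono (IsFiltered.rightToMax U Z) ha
  obtain ⟨v₁, hv₁⟩ := ρ₁.localizable U₁'
  obtain ⟨v₂, hv₂⟩ := ρ₂.localizable U₂'
  have hm₁ := ρ₁.transporter_mem hR j₁ j₁' hv₁
  have hm₂ := ρ₂.transporter_mem hR j₂ j₂' hv₂
  let w₁ : R.universal := ⟨v₁, R.mem_universal hm₁⟩
  let w₂ : R.universal := ⟨v₂, R.mem_universal hm₂⟩
  have hw₁ : star w₁ * w₁ = 1 := Subtype.ext (Unitary.coe_star_mul_self v₁)
  have hw₂ : star w₂ * w₂ = 1 := Subtype.ext (Unitary.coe_star_mul_self v₂)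
  -- The transporters live in V₁ and V₂, which are orthogonal in W.
  have hw : w₁ * w₂ = w₂ * w₁ := Subtype.ext (hR.commute hk hm₁ hm₂)
  -- Since a is localized orthogonally to U₁', transport of ρ₁ to U₁' trivializes it on a; solving
  -- for ρ₁(a) gives the conjugation.
  have e₁ : ρ₁.toHom a = star w₁ * a * w₁ := by
    have h : w₁ * ρ₁.toHom a = a * w₁ := Subtype.ext (hv₁ k _ hk₁.symm a ha')
    rw [mul_assoc, ← h, ← mul_assoc, hw₁, one_mul]
  have e₂ : ρ₂.toHom a = star w₂ * a * w₂ := by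
    have h : w₂ * ρ₂.toHom a = a * w₂ := Subtype.ext (hv₂ k _ hk₂.symm a ha')
    rw [mul_assoc, ← h, ← mul_assoc, hw₂, one_mul]
  -- The region U₁ lies in V₁, hence is orthogonal to V₂ where w₂ is localized.
  have t₁ : ρ₁.toHom w₂ = w₂ := ρ₁.toHom_eq_self (hk.symm.precomp_right j₁) hm₂
  have t₂ : ρ₂.toHom w₁ = w₁ := ρ₂.toHom_eq_self (hk.precomp_right j₂) hm₁
  show ρ₁.toHom (ρ₂.toHom a) = ρ₂.toHom (ρ₁.toHom a)
  rw [e₁, e₂, map_mul, map_mul, map_mul, map_mul, map_star, map_star, t₁, t₂, e₁, e₂]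
  have hws : star w₂ * star w₁ = star w₁ * star w₂ := by rw [← star_mul, hw, star_mul]
  calc star w₂ * (star w₁ * a * w₁) * w₂ = (star w₂ * star w₁) * a * (w₁ * w₂) := by
        simp only [mul_assoc]
    _ = star w₁ * (star w₂ * a * w₂) * w₁ := by rw [hws, hw]; simp only [mul_assoc]

end Sector

/-! ### Composition of endomorphisms as a strict monoidal product. -/

/-- The strict monoidal structure on the `C*`-category of localized sectors. -/
noncomputable def strictMonoidal [IsFiltered C] (hR : R.IsHaagDual) (U : C) :
    StrictMonoidal (R.sss U) where
  tensorObj := Sector.mul hR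
  unit := Sector.one R U
  tensorHom := Sector.mulHom hR
  tensor_id ρ σ := Sector.ext_hom (by
    show (1 : H →L[ℂ] H) * (Sector.toHom ρ 1 : H →L[ℂ] H) = 1
    simp)
  tensor_comp {ρ ρ' ρ'' σ σ' σ''} T T' S S' := Sector.ext_hom (by
    show T'.1 * T.1 * (Sector.toHom ρ (Sector.opUniversal S' * Sector.opUniversal S) : H →L[ℂ] H) =
      T'.1 * (Sector.toHom ρ' (Sector.opUniversal S') : H →L[ℂ] H) *
        (T.1 * (Sector.toHom ρ (Sector.opUniversal S) : H →L[ℂ] H))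
    -- The interchange law is the intertwining relation T ρ(S') = ρ'(S') T.
    rw [map_mul, mul_assoc, mul_assoc, ← mul_assoc (Sector.toHom ρ' _ : H →L[ℂ] H), ← T.2.2,
      mul_assoc]
    rfl)
  add_tensor T T' S := Sector.ext_hom (add_mul _ _ _)
  tensor_add {ρ _ _ _} T S S' := Sector.ext_hom (by
    show T.1 * (Sector.toHom ρ (Sector.opUniversal S + Sector.opUniversal S') : H →L[ℂ] H) = _
    rw [map_add]
    exact mul_add _ _ _)
  smul_tensor z T S := Sector.ext_hom (smul_mul_assoc _ _ _)
  tensor_smul {ρ _ _ _} z T S := Sector.ext_hom (by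
    show T.1 * (Sector.toHom ρ (z • Sector.opUniversal S) : H →L[ℂ] H) = _
    rw [map_smul]
    exact mul_smul_comm _ _ _)
  tensor_dagger {ρ ρ' _ _} T S := Sector.ext_hom (by
    show star T.1 * (Sector.toHom ρ' (star (Sector.opUniversal S)) : H →L[ℂ] H) =
      star (T.1 * (Sector.toHom ρ (Sector.opUniversal S) : H →L[ℂ] H))
    -- The adjoint T* intertwines ρ' with ρ, which moves it past ρ'(S*) into the order produced by
    -- the adjoint of T ρ(S).
    rw [(Sector.dagger_mem T.2).2, star_mul, map_star]
    rfl)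
  assoc_obj _ _ _ := rfl
  assoc_hom {ρ ρ' σ σ' τ τ'} T S K := heq_of_eq (Sector.ext_hom (by
    show T.1 * (Sector.toHom ρ (Sector.opUniversal S) : H →L[ℂ] H) *
        (Sector.toHom ρ (Sector.toHom σ (Sector.opUniversal K)) : H →L[ℂ] H) =
      T.1 * (Sector.toHom ρ (Sector.opUniversal S * Sector.toHom σ (Sector.opUniversal K)) : H →L[ℂ] H)
    rw [map_mul, mul_assoc]
    rfl))
  unit_tensor_obj _ := rfl
  unit_tensor_hom T := heq_of_eq (Sector.ext_hom (one_mul _))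
  tensor_unit_obj _ := rfl
  tensor_unit_hom {ρ ρ'} T := heq_of_eq (Sector.ext_hom (by
    show T.1 * (Sector.toHom ρ 1 : H →L[ℂ] H) = T.1
    simp))

end VNNet
-- Factorization products along operations.
-- The involution reverses the order of a product; commutation of distinct factors restores it.
theorem star_prod_ofFn {N : Type*} [Monoid N] [StarMul N] : ∀ {n : ℕ} (x : Fin n → N),
    (∀ i j, i ≠ j → Commute (x i) (x j)) →
      (List.ofFn fun i => star (x i)).prod = star (List.ofFn x).prod
  | 0, _, _ => by simp
  | n + 1, x, h => by
    have hc : Commute (x 0) (List.ofFn fun i : Fin n => x i.succ).prod :=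
      commute_prod_ofFn fun i => h 0 i.succ (Fin.succ_ne_zero i).symm
    simp only [List.ofFn_succ, List.prod_cons]
    rw [star_prod_ofFn (fun i => x i.succ) fun i j hij => h _ _ ((Fin.succ_injective n).ne hij),
      hc.eq, star_mul]

namespace OrthCat.Op

variable {C : OrthCat.{v, u}}

/-- The restriction of an operation to all inputs but the first one. -/
def tail {n : ℕ} {U : Fin (n + 1) → C} {V : C} (f : C.Op U V) : C.Op (fun i : Fin n => U i.succ) V :=
  ⟨fun i => f.1 i.succ, fun _ _ h => f.2 _ _ ((Fin.succ_injective n).ne h)⟩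

/-- Inputs in one block are orthogonal already before postcomposition, inputs in different blocks
because the blocks are. This supplies the commutation needed to regroup products along a composite
operation. -/
theorem comp_perp {n : ℕ} {U : Fin n → C} {V : C} (f : C.Op U V) {k : Fin n → ℕ}
    {W : ∀ i, Fin (k i) → C} (g : ∀ i, C.Op (W i) (U i)) {p q : (i : Fin n) × Fin (k i)}
    (h : p ≠ q) : C.Perp ((g p.1).1 p.2 ≫ f.1 p.1) ((g q.1).1 q.2 ≫ f.1 q.1) := by
  obtain ⟨i, l⟩ := p
  obtain ⟨i', l'⟩ := q
  by_cases hi : i = i'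
  · subst hi
    exact ((g i).2 l l' fun hl => h (by rw [hl])).postcomp _
  · exact C.orth.precomp _ _ (f.2 i i' hi)

end OrthCat.Op

namespace VNNet

variable {H : Type u₁} [NormedAddCommGroup H] [InnerProductSpace ℂ H] [CompleteSpace H]
variable {C : OrthCat.{v, u}} {R : VNNet H C}

namespace Sector

variable {U V : C}

theorem ext_opUniversal {ρ σ : R.Sector U} {T S : ρ ⟶ σ} (h : opUniversal T = opUniversal S) :
    T = S :=
  ext_hom (congrArg (fun a : R.universal => (a : H →L[ℂ] H)) h)

theorem heq_of_opUniversal_eq {ρ σ ρ' σ' : R.Sector U} (hρ : ρ.toHom = ρ'.toHom)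
    (hσ : σ.toHom = σ'.toHom) {T : ρ ⟶ σ} {S : ρ' ⟶ σ'} (h : opUniversal T = opUniversal S) :
    HEq T S :=
  heq_of_op_eq hρ hσ (congrArg (fun a : R.universal => (a : H →L[ℂ] H)) h)

theorem opUniversal_commute (hR : R.IsHaagDual) {U₁ U₂ : C} {f₁ : U₁ ⟶ V} {f₂ : U₂ ⟶ V}
    (h : C.Perp f₁ f₂) {ρ σ : R.Sector U₁} {ρ' σ' : R.Sector U₂} (T : ρ ⟶ σ) (S : ρ' ⟶ σ') :
    Commute (opUniversal T) (opUniversal S) :=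
  Subtype.ext (hR.commute h T.2.1 S.2.1)

theorem prod_ofFn_apply_eq_self : ∀ {n : ℕ} (φ : Fin n → (R.universal →⋆ₐ[ℂ] R.universal))
    {a : R.universal}, (∀ i, φ i a = a) → (List.ofFn φ).prod a = a
  | 0, _, _, _ => rfl
  | n + 1, φ, a, h => by
    rw [List.ofFn_succ, List.prod_cons]
    show φ 0 ((List.ofFn fun i : Fin n => φ i.succ).prod a) = a
    rw [prod_ofFn_apply_eq_self _ fun i => h i.succ, h 0]

/-- On the local algebra of one of the inputs of an operation, the product of localized
endomorphisms acts as the endomorphism localized there. -/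
theorem prod_ofFn_toHom_apply (hR : R.IsHaagDual) : ∀ {n : ℕ} {U : Fin n → C} (_ : C.Op U V)
    (ρ : ∀ i, R.Sector (U i)) (j : Fin n) {a : R.universal}, (a : H →L[ℂ] H) ∈ R.alg (U j) →
      (List.ofFn fun i => (ρ i).toHom).prod a = (ρ j).toHom a
  | 0, _, _, _, j, _, _ => j.elim0
  | n + 1, U, f, ρ, j, a, ha => by
    rw [List.ofFn_succ, List.prod_cons]
    show (ρ 0).toHom ((List.ofFn fun i : Fin n => (ρ i.succ).toHom).prod a) = _
    induction j using Fin.cases with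
    | zero =>
      rw [prod_ofFn_apply_eq_self _ fun i => (ρ i.succ).toHom_eq_self
        (f.2 0 i.succ (Fin.succ_ne_zero i).symm) ha]
    | succ j =>
      rw [prod_ofFn_toHom_apply hR f.tail (fun i => ρ i.succ) j ha]
      -- The image under the endomorphism with index `j.succ` stays in the algebra of its own
      -- region, on which the first endomorphism is trivial.
      exact (ρ 0).toHom_eq_self (f.2 j.succ 0 (Fin.succ_ne_zero j)) ((ρ j.succ).toHom_mem hR ha)

variable [IsFiltered C]

theorem toHom_tensorPow (hR : R.IsHaagDual) : ∀ {n : ℕ} (ρ : Fin n → R.Sector U),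
    Sector.toHom ((strictMonoidal hR U).tensorPow n ρ) = (List.ofFn fun i => (ρ i).toHom).prod
  | 0, _ => rfl
  | n + 1, ρ => by
    rw [List.ofFn_succ, List.prod_cons, ← toHom_tensorPow hR fun i => ρ i.succ]
    rfl

/-- In each product T₀ ρ₀(T) the operator T is built from local algebras orthogonal to the first
region, and ρ₀ fixes these. The twists disappear, leaving a plain operator product to which
causality applies. -/
theorem opUniversal_tensorPowHom (hR : R.IsHaagDual) : ∀ {n : ℕ} {U : Fin n → C} (f : C.Op U V)
    {ρ σ : ∀ i, R.Sector (U i)} (T : ∀ i, ρ i ⟶ σ i),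
    opUniversal ((strictMonoidal hR V).tensorPowHom n fun i => inclHom (f.1 i) (T i)) =
      (List.ofFn fun i => opUniversal (T i)).prod
  | 0, _, _, _, _, _ => rfl
  | n + 1, U, f, ρ, σ, T => by
    have ih := opUniversal_tensorPowHom hR f.tail fun i => T i.succ
    have hfix : (ρ 0).toHom (List.ofFn fun i : Fin n => opUniversal (T i.succ)).prod =
        (List.ofFn fun i : Fin n => opUniversal (T i.succ)).prod := by
      rw [map_list_prod, List.map_ofFn]
      congr 2
      funext i
      exact (ρ 0).toHom_eq_self (f.2 i.succ 0 (Fin.succ_ne_zero i)) (T i.succ).2.1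
    rw [List.ofFn_succ, List.prod_cons, ← hfix, ← ih]
    rfl

end Sector

variable [IsFiltered C] (hR : R.IsHaagDual)

/-- The strict monoidal `C*`-categories of localized sectors. -/
noncomputable def monSSS (U : C) : MonCStarCat.{u₁, u₁} := ⟨R.sss U, strictMonoidal hR U⟩

/-- The product of sectors along an operation. -/
noncomputable def factorObj {n : ℕ} {U : Fin n → C} {V : C} (f : C.Op U V)
    (ρ : ∀ i, R.Sector (U i)) : R.Sector V :=
  (strictMonoidal hR V).tensorPow n fun i => Sector.incl (f.1 i) (ρ i)

/-- The product of morphisms of sectors along an operation. -/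
noncomputable def factorHom {n : ℕ} {U : Fin n → C} {V : C} (f : C.Op U V)
    {ρ σ : ∀ i, R.Sector (U i)} (T : ∀ i, ρ i ⟶ σ i) : factorObj hR f ρ ⟶ factorObj hR f σ :=
  (strictMonoidal hR V).tensorPowHom n fun i => Sector.inclHom (f.1 i) (T i)

theorem toHom_factorObj {n : ℕ} {U : Fin n → C} {V : C} (f : C.Op U V)
    (ρ : ∀ i, R.Sector (U i)) :
    (factorObj hR f ρ).toHom = (List.ofFn fun i => (ρ i).toHom).prod :=
  Sector.toHom_tensorPow hR _

theorem opUniversal_factorHom {n : ℕ} {U : Fin n → C} {V : C} (f : C.Op U V)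
    {ρ σ : ∀ i, R.Sector (U i)} (T : ∀ i, ρ i ⟶ σ i) :
    Sector.opUniversal (factorHom hR f T) = (List.ofFn fun i => Sector.opUniversal (T i)).prod :=
  Sector.opUniversal_tensorPowHom hR f T

theorem commute_toHom_of_op (hR : R.IsHaagDual) (hC : C.HasSeparatedTransport) {n : ℕ} {U : Fin n → C} {V : C}
    (f : C.Op U V) (ρ σ : ∀ i, R.Sector (U i)) (i j : Fin n) (h : i ≠ j) :
    Commute (ρ i).toHom (σ j).toHom :=
  Sector.commute_toHom hR hC (f.2 i j h) _ _

section

variable {n : ℕ} {U : Fin n → C} {V : C} (f : C.Op U V)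

/-- Reduces multilinearity of the factorization product to that of multiplication in R_⋆. -/
theorem opUniversal_factorHom_update [DecidableEq (Fin n)] {ρ σ : ∀ i, R.Sector (U i)}
    (T : ∀ i, ρ i ⟶ σ i) (i : Fin n) (S : ρ i ⟶ σ i) :
    Sector.opUniversal (factorHom hR f (Function.update T i S)) =
      MultilinearMap.mkPiAlgebraFin ℂ n R.universal
        (Function.update (fun j => Sector.opUniversal (T j)) i (Sector.opUniversal S)) := by
  rw [opUniversal_factorHom, MultilinearMap.mkPiAlgebraFin_apply]
  congr 2
  funext j
  exact Function.apply_update (fun _ => Sector.opUniversal) T i S j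

theorem factorHom_update_add [DecidableEq (Fin n)] {ρ σ : ∀ i, R.Sector (U i)} (T : ∀ i, ρ i ⟶ σ i)
    (i : Fin n) (S S' : ρ i ⟶ σ i) :
    factorHom hR f (Function.update T i (S + S')) =
      factorHom hR f (Function.update T i S) + factorHom hR f (Function.update T i S') := by
  refine Sector.ext_opUniversal ?_
  rw [opUniversal_factorHom_update,
    show Sector.opUniversal (S + S') = Sector.opUniversal S + Sector.opUniversal S' from rfl,
    MultilinearMap.map_update_add, ← opUniversal_factorHom_update, ← opUniversal_factorHom_update]
  rfl

theorem factorHom_update_smul [DecidableEq (Fin n)] {ρ σ : ∀ i, R.Sector (U i)} (T : ∀ i, ρ i ⟶ σ i)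
    (i : Fin n) (z : ℂ) (S : ρ i ⟶ σ i) :
    factorHom hR f (Function.update T i (z • S)) =
      z • factorHom hR f (Function.update T i S) := by
  refine Sector.ext_opUniversal ?_
  rw [opUniversal_factorHom_update,
    show Sector.opUniversal (z • S) = z • Sector.opUniversal S from rfl,
    MultilinearMap.map_update_smul, ← opUniversal_factorHom_update]
  rfl

theorem factorHom_id (ρ : ∀ i, R.Sector (U i)) :
    factorHom hR f (fun i => 𝟙 (ρ i)) = 𝟙 (factorObj hR f ρ) := by
  refine Sector.ext_opUniversal ?_
  rw [opUniversal_factorHom]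
  exact List.prod_eq_one fun a ha => by
    obtain ⟨i, rfl⟩ := List.mem_ofFn.mp ha
    rfl

theorem factorHom_comp {ρ σ τ : ∀ i, R.Sector (U i)} (S : ∀ i, ρ i ⟶ σ i) (T : ∀ i, σ i ⟶ τ i) :
    factorHom hR f (fun i => S i ≫ T i) = factorHom hR f S ≫ factorHom hR f T := by
  refine Sector.ext_opUniversal ?_
  -- The composite `S i ≫ T i` is the operator product T S, so the family T comes first.
  have h := prod_ofFn_mul (fun i => Sector.opUniversal (T i)) (fun i => Sector.opUniversal (S i))
    fun i j hij => Sector.opUniversal_commute hR (f.2 i j hij) (T i) (S j)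
  rw [← opUniversal_factorHom hR f, ← opUniversal_factorHom hR f] at h
  rw [opUniversal_factorHom]
  exact h

theorem factorHom_dagger {ρ σ : ∀ i, R.Sector (U i)} (T : ∀ i, ρ i ⟶ σ i) :
    factorHom hR f (fun i => CStarCategory.dagger (T i)) =
      CStarCategory.dagger (factorHom hR f T) := by
  refine Sector.ext_opUniversal ?_
  have h := star_prod_ofFn (fun i => Sector.opUniversal (T i))
    fun i j hij => Sector.opUniversal_commute hR (f.2 i j hij) (T i) (T j)
  rw [← opUniversal_factorHom hR f] at h
  rw [opUniversal_factorHom]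
  exact h

/-- Interchange for endomorphisms: each σ_i passes the ρ_j with j ≠ i because their localization
regions are orthogonal. Here the geometric assumption makes the factorization products monoidal. -/
theorem toHom_factorObj_mul (hC : C.HasSeparatedTransport) (ρ σ : ∀ i, R.Sector (U i)) :
    (factorObj hR f fun i => Sector.mul hR (ρ i) (σ i)).toHom =
      (Sector.mul hR (factorObj hR f ρ) (factorObj hR f σ)).toHom := by
  have h := prod_ofFn_mul (fun i => (ρ i).toHom) (fun i => (σ i).toHom)
    (commute_toHom_of_op hR hC f ρ σ)
  rw [← toHom_factorObj hR f, ← toHom_factorObj hR f] at h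
  rw [toHom_factorObj]
  exact h

/-- The operator ρ_j(T_j) stays in the j-th local algebra, so causality separates the S_i from the
ρ_j(T_j). The full product of the ρ_j acts on T_i as ρ_i alone, which recovers the twist of the
monoidal product in V. -/
theorem opUniversal_factorHom_mul {ρ ρ' σ σ' : ∀ i, R.Sector (U i)}
    (S : ∀ i, ρ i ⟶ ρ' i) (T : ∀ i, σ i ⟶ σ' i) :
    Sector.opUniversal (factorHom hR f fun i => Sector.mulHom hR (S i) (T i)) =
      Sector.opUniversal (Sector.mulHom hR (factorHom hR f S) (factorHom hR f T)) := by
  rw [opUniversal_factorHom]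
  have h := prod_ofFn_mul (fun i => Sector.opUniversal (S i))
    (fun i => (ρ i).toHom (Sector.opUniversal (T i)))
    fun i j hij => Subtype.ext
      (hR.commute (f.2 i j hij) (S i).2.1 ((ρ j).toHom_mem hR (T j).2.1))
  have h' : (List.ofFn fun i => (ρ i).toHom (Sector.opUniversal (T i))).prod =
      (factorObj hR f ρ).toHom (List.ofFn fun i => Sector.opUniversal (T i)).prod := by
    rw [map_list_prod, List.map_ofFn]
    congr 2
    funext i
    show _ = (factorObj hR f ρ).toHom (Sector.opUniversal (T i))
    rw [toHom_factorObj]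
    exact (Sector.prod_ofFn_toHom_apply hR f ρ i (T i).2.1).symm
  rw [h', ← opUniversal_factorHom hR f, ← opUniversal_factorHom hR f] at h
  exact h

end

/-- The product of sectors along an operation, as an object of the monoidal category. -/
noncomputable def factorizationObj {n : ℕ} {U : Fin n → C} {V : C} (f : C.Op U V)
    (ρ : ∀ i, monSSS hR (U i)) : monSSS hR V :=
  factorObj hR f ρ

/-- The product of morphisms of sectors along an operation, as a multilinear map. -/
noncomputable def factorizationMap {n : ℕ} {U : Fin n → C} {V : C} (f : C.Op U V)
    {ρ σ : ∀ i, monSSS hR (U i)} :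
    MultilinearMap ℂ (fun i => ρ i ⟶ σ i) (factorizationObj hR f ρ ⟶ factorizationObj hR f σ) where
  toFun T := factorHom hR f T
  map_update_add' T i S S' := factorHom_update_add hR f T i S S'
  map_update_smul' T i z S := factorHom_update_smul hR f T i z S

/-- The factorization product of localized sectors along an operation. -/
noncomputable def factorization (hC : C.HasSeparatedTransport) {n : ℕ} {U : Fin n → C} {V : C}
    (f : C.Op U V) : MultiFunctor (fun i => monSSS hR (U i)) (monSSS hR V) where
  obj ρ := factorizationObj hR f ρ
  map := factorizationMap hR f
  map_id ρ := factorHom_id hR f ρ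
  map_comp S T := factorHom_comp hR f S T
  map_dagger T := factorHom_dagger hR f T
  obj_unit := Sector.ext (by
    refine (toHom_factorObj hR f _).trans (List.prod_eq_one fun φ hφ => ?_)
    obtain ⟨i, rfl⟩ := List.mem_ofFn.mp hφ
    rfl)
  obj_tensor ρ σ := Sector.ext (toHom_factorObj_mul hR f hC ρ σ)
  map_tensor {ρ ρ' σ σ'} S T := Sector.heq_of_opUniversal_eq
    (toHom_factorObj_mul hR f hC ρ σ) (toHom_factorObj_mul hR f hC ρ' σ')
    (opUniversal_factorHom_mul hR f S T)

/-! ### Operadic axioms and local constancy. -/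

section

variable {n : ℕ} {U : Fin n → C} {V : C}

theorem toHom_factorObj_single {U : C} (f : U ⟶ V) (ρ : R.Sector U) :
    (factorObj hR (.single f) fun _ => ρ).toHom = ρ.toHom := by
  rw [toHom_factorObj]
  simp

theorem opUniversal_factorHom_single {U : C} (f : U ⟶ V) {ρ σ : R.Sector U} (T : ρ ⟶ σ) :
    Sector.opUniversal (factorHom hR (.single f) fun _ => T) = Sector.opUniversal T := by
  rw [opUniversal_factorHom]
  simp

theorem toHom_factorObj_comp (hC : C.HasSeparatedTransport) (f : C.Op U V) {k : Fin n → ℕ}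
    {W : ∀ i, Fin (k i) → C} (g : ∀ i, C.Op (W i) (U i)) (ρ : ∀ i l, R.Sector (W i l)) :
    (factorObj hR (f.comp g) fun j =>
        ρ (finSigmaFinEquiv.symm j).1 (finSigmaFinEquiv.symm j).2).toHom =
      (factorObj hR f fun i => factorObj hR (g i) (ρ i)).toHom := by
  rw [toHom_factorObj, toHom_factorObj]
  simp only [toHom_factorObj]
  exact prod_ofFn_finSigma (fun i l => (ρ i l).toHom)
    fun p q hpq => Sector.commute_toHom hR hC (f.comp_perp g hpq) _ _

theorem opUniversal_factorHom_opComp (f : C.Op U V) {k : Fin n → ℕ}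
    {W : ∀ i, Fin (k i) → C} (g : ∀ i, C.Op (W i) (U i)) {ρ σ : ∀ i l, R.Sector (W i l)}
    (T : ∀ i l, ρ i l ⟶ σ i l) :
    Sector.opUniversal (factorHom hR (f.comp g) fun j =>
        T (finSigmaFinEquiv.symm j).1 (finSigmaFinEquiv.symm j).2) =
      Sector.opUniversal (factorHom hR f fun i => factorHom hR (g i) (T i)) := by
  rw [opUniversal_factorHom, opUniversal_factorHom]
  simp only [opUniversal_factorHom]
  exact prod_ofFn_finSigma (fun i l => Sector.opUniversal (T i l))
    fun p q hpq => Sector.opUniversal_commute hR (f.comp_perp g hpq) _ _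

theorem toHom_factorObj_perm (hC : C.HasSeparatedTransport) (f : C.Op U V)
    (τ : Equiv.Perm (Fin n)) (ρ : ∀ i, R.Sector (U i)) :
    (factorObj hR (f.perm τ) fun i => ρ (τ i)).toHom = (factorObj hR f ρ).toHom := by
  rw [toHom_factorObj, toHom_factorObj]
  exact prod_ofFn_perm (fun i => (ρ i).toHom) (commute_toHom_of_op hR hC f ρ ρ) τ

theorem opUniversal_factorHom_perm (f : C.Op U V) (τ : Equiv.Perm (Fin n))
    {ρ σ : ∀ i, R.Sector (U i)} (T : ∀ i, ρ i ⟶ σ i) :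
    Sector.opUniversal (factorHom hR (f.perm τ) fun i => T (τ i)) =
      Sector.opUniversal (factorHom hR f T) := by
  rw [opUniversal_factorHom, opUniversal_factorHom]
  exact prod_ofFn_perm (fun i => Sector.opUniversal (T i))
    (fun i j hij => Sector.opUniversal_commute hR (f.2 i j hij) _ _) τ

end

/-- The prefactorization algebra of localized sectors. -/
noncomputable def pfaStr (hC : C.HasSeparatedTransport) : PFAStr C (monSSS hR) where
  prod f := factorization hR hC f
  id_obj V ρ := Sector.ext (toHom_factorObj_single hR (𝟙 V) ρ)
  id_map V {ρ σ} T := Sector.heq_of_opUniversal_eq (toHom_factorObj_single hR (𝟙 V) ρ)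
    (toHom_factorObj_single hR (𝟙 V) σ) (opUniversal_factorHom_single hR (𝟙 V) T)
  comp_obj {_ _ _} f {_ _} g ρ := Sector.ext (toHom_factorObj_comp hR hC f g ρ)
  comp_map {_ _ _} f {_ _} g {ρ σ} T := Sector.heq_of_opUniversal_eq (toHom_factorObj_comp hR hC f g ρ)
    (toHom_factorObj_comp hR hC f g σ) (opUniversal_factorHom_opComp hR f g T)
  perm_obj {_ _ _} f τ ρ := Sector.ext (toHom_factorObj_perm hR hC f τ ρ)
  perm_map {_ _ _} f τ {ρ σ} T := Sector.heq_of_opUniversal_eq (toHom_factorObj_perm hR hC f τ ρ)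
    (toHom_factorObj_perm hR hC f τ σ) (opUniversal_factorHom_perm hR f τ T)

theorem bijective_factorHom_single {U V : C} (f : U ⟶ V) (ρ σ : R.Sector U) :
    Function.Bijective fun T : ρ ⟶ σ => factorHom hR (.single f) fun _ => T := by
  refine ⟨fun T S h => ?_, fun S => ?_⟩
  · have h' := congrArg Sector.opUniversal h
    simp only [opUniversal_factorHom_single] at h'
    exact Sector.ext_opUniversal h'
  · have hS := S.2.2
    simp only [toHom_factorObj_single] at hS
    -- Fullness: an intertwiner found in R(V) already lies in R(U) by duality.
    exact ⟨⟨S.1, Sector.hom_mem hR hS, hS⟩,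
      Sector.ext_opUniversal (opUniversal_factorHom_single hR f _)⟩

theorem isLocallyConstant_pfaStr (hC : C.HasSeparatedTransport) :
    (pfaStr hR hC).IsLocallyConstant := by
  refine fun {U V} f => ⟨bijective_factorHom_single hR f, fun σ => ?_⟩
  obtain ⟨ρ, t, h₁, h₂⟩ := Sector.exists_transport hR f σ
  -- The transporter starts at `incl f ρ`, whereas the one-fold product carries an extra unit
  -- factor; equality of the two sectors allows the source to be exchanged.
  obtain ⟨ρ', hρ', rfl⟩ : ∃ ρ', ρ' = factorObj hR (.single f) (fun _ => ρ) ∧ ρ' = Sector.incl f ρ :=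
    ⟨_, rfl, Sector.ext (toHom_factorObj_single hR f ρ)⟩
  refine ⟨ρ, ?_⟩
  show ∃ t : factorObj hR (.single f) (fun _ => ρ) ⟶ σ, IsUnitaryMor (A := R.sss V) t
  rw [← hρ']
  exact ⟨t, Sector.ext_hom h₁, Sector.ext_hom h₂⟩

end VNNet
/-! ### Covariant nets -/

section Action

variable {G : Type u₁} [Group G] (X : SingleObj G ⥤ OrthCat.{v, u})

theorem orthAct_one : orthAct X 1 = 𝟙 (orthBase X) := X.map_id (SingleObj.star G)

/-- Composition in `SingleObj G` is multiplication in reversed order. -/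
theorem orthAct_mul (g g' : G) : orthAct X (g * g') = orthAct X g' ≫ orthAct X g :=
  X.map_comp (X := SingleObj.star G) (Y := SingleObj.star G) (Z := SingleObj.star G) g' g

/-- The action is strict, so this is an equality of objects. It is the reason why the action on
sectors is set up with a variable target and a proof that this is gU: the inverse then lands in the
sectors of U itself. -/
theorem orthAct_obj_orthAct_obj {g g' : G} (h : g * g' = 1) (U : orthBase X) :
    (orthAct X g).functor.obj ((orthAct X g').functor.obj U) = U :=
  (congrArg (fun α : OrthCat.Hom (orthBase X) (orthBase X) => α.functor.obj U)
    ((orthAct_mul X g g').symm.trans ((congrArg (orthAct X) h).trans (orthAct_one X))) : _)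

end Action

namespace VNNet

variable {H : Type u'} [NormedAddCommGroup H] [InnerProductSpace ℂ H] [CompleteSpace H]
variable {G : Type u₁} [Group G] {X : SingleObj G ⥤ OrthCat.{v, u}}

/-- A net is covariant with respect to an action of `G` on the bounded operators if the latter maps
the local algebra of `U` to the one of `g U`. -/
def IsCovariant (R : VNNet H (orthBase X)) (θ : G →* ((H →L[ℂ] H) ≃⋆ₐ[ℂ] (H →L[ℂ] H))) : Prop :=
  ∀ (g : G) (U : orthBase X) (T : H →L[ℂ] H), T ∈ R.alg U →
    θ g T ∈ R.alg ((orthAct X g).functor.obj U)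

variable {R : VNNet H (orthBase X)} {θ : G →* ((H →L[ℂ] H) ≃⋆ₐ[ℂ] (H →L[ℂ] H))}

/-- The preimage of R_⋆ under an isometric `*`-automorphism is a closed subalgebra, and by
covariance it contains every local algebra. -/
theorem IsCovariant.mem_universal (hθ : R.IsCovariant θ) (g : G) {T : H →L[ℂ] H}
    (hT : T ∈ R.universal) : θ g T ∈ R.universal := by
  have hle : R.universal ≤ R.universal.comap (θ g).toStarAlgHom := by
    refine StarSubalgebra.topologicalClosure_minimal
      (iSup_le fun U T hT => R.mem_universal (hθ g U T hT)) ?_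
    exact (isClosed_universal (R := R)).preimage (StarAlgEquiv.isometry (θ g)).continuous
  exact hle hT

/-- The induced action on the universal algebra. -/
noncomputable def IsCovariant.restrict (hθ : R.IsCovariant θ) :
    G →* (R.universal →⋆ₐ[ℂ] R.universal) where
  toFun g := StarAlgHom.codRestrict
    ((θ g).toStarAlgHom.comp R.universal.subtype) R.universal
    fun a => hθ.mem_universal g a.2
  map_one' := StarAlgHom.ext fun a => Subtype.ext (by
    show θ 1 (a : H →L[ℂ] H) = a
    rw [map_one]
    rfl)
  map_mul' g g' := StarAlgHom.ext fun a => Subtype.ext (by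
    show θ (g * g') (a : H →L[ℂ] H) = θ g (θ g' a)
    rw [map_mul]
    rfl)

theorem IsCovariant.coe_restrict (hθ : R.IsCovariant θ) (g : G) (a : R.universal) :
    (hθ.restrict g a : H →L[ℂ] H) = θ g a := rfl

theorem IsCovariant.restrict_mem (hθ : R.IsCovariant θ) (g : G) {U V : orthBase X}
    (h : (orthAct X g).functor.obj U = V) {a : R.universal} (ha : (a : H →L[ℂ] H) ∈ R.alg U) :
    (hθ.restrict g a : H →L[ℂ] H) ∈ R.alg V :=
  h ▸ hθ g U a ha

theorem IsCovariant.restrict_apply_restrict (hθ : R.IsCovariant θ) {g g' : G} (h : g * g' = 1)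
    (a : R.universal) : hθ.restrict g (hθ.restrict g' a) = a := by
  show (hθ.restrict g * hθ.restrict g') a = a
  rw [← map_mul, h, map_one]
  rfl

/-- Conjugation of endomorphisms of the universal algebra by the action of `G`. -/
noncomputable def IsCovariant.conj (hθ : R.IsCovariant θ) (g : G) :
    (R.universal →⋆ₐ[ℂ] R.universal) →* (R.universal →⋆ₐ[ℂ] R.universal) where
  toFun φ := hθ.restrict g * φ * hθ.restrict g⁻¹
  map_one' := by rw [mul_one, ← map_mul, mul_inv_cancel, map_one]
  map_mul' φ ψ := by
    have h : hθ.restrict g⁻¹ * hθ.restrict g = 1 := by rw [← map_mul, inv_mul_cancel, map_one]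
    calc hθ.restrict g * (φ * ψ) * hθ.restrict g⁻¹ =
          hθ.restrict g * φ * 1 * ψ * hθ.restrict g⁻¹ := by simp only [mul_assoc, one_mul]
      _ = _ := by rw [← h]; simp only [mul_assoc]

theorem IsCovariant.conj_apply (hθ : R.IsCovariant θ) (g : G)
    (φ : R.universal →⋆ₐ[ℂ] R.universal) (a : R.universal) :
    hθ.conj g φ a = hθ.restrict g (φ (hθ.restrict g⁻¹ a)) := rfl

theorem IsCovariant.conj_one (hθ : R.IsCovariant θ) (φ : R.universal →⋆ₐ[ℂ] R.universal) :
    hθ.conj 1 φ = φ := by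
  show hθ.restrict 1 * φ * hθ.restrict 1⁻¹ = φ
  rw [inv_one, map_one, one_mul, mul_one]

theorem IsCovariant.conj_conj (hθ : R.IsCovariant θ) (g g' : G)
    (φ : R.universal →⋆ₐ[ℂ] R.universal) :
    hθ.conj g (hθ.conj g' φ) = hθ.conj (g * g') φ := by
  show hθ.restrict g * (hθ.restrict g' * φ * hθ.restrict g'⁻¹) * hθ.restrict g⁻¹ =
    hθ.restrict (g * g') * φ * hθ.restrict (g * g')⁻¹
  rw [mul_inv_rev, map_mul, map_mul]
  simp only [mul_assoc]

/-! ### The action of G on localized sectors. -/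

namespace Sector

variable (hθ : R.IsCovariant θ)

/-- The action of `g` on localized sectors. -/
noncomputable def act (g : G) {U V : orthBase X} (h : (orthAct X g).functor.obj U = V)
    (ρ : R.Sector U) : R.Sector V where
  toHom := hθ.conj g ρ.toHom
  localizable W := by
    -- If w transports ρ to g⁻¹W, then its image under the action of g transports the conjugated
    -- endomorphism to W.
    obtain ⟨w, hw⟩ := ρ.localizable ((orthAct X g⁻¹).functor.obj W)
    refine ⟨⟨θ g w, Unitary.map_mem (θ g) w.2⟩, fun f' f hp a ha => ?_⟩
    have h := congrArg (θ g) (hw _ _ ((orthAct X g⁻¹).map_perp hp) (hθ.restrict g⁻¹ a)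
      (hθ.restrict_mem g⁻¹ rfl ha))
    rw [map_mul, map_mul, ← hθ.coe_restrict, ← hθ.coe_restrict, ← hθ.conj_apply,
      hθ.restrict_apply_restrict (mul_inv_cancel g)] at h
    exact h
  localized {U' V'} f' f hp a ha := by
    -- Pulling back by g⁻¹ yields a cospan orthogonal to g⁻¹V, which is U only up to an equality of
    -- objects; hence the `eqToHom` below.
    have hU : U = (orthAct X g⁻¹).functor.obj V := by
      rw [← h, orthAct_obj_orthAct_obj X (inv_mul_cancel g)]
    rw [hθ.conj_apply, ρ.toHom_eq_self
      (((orthAct X g⁻¹).map_perp hp).precomp_right (eqToHom hU)) (hθ.restrict_mem g⁻¹ rfl ha),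
      hθ.restrict_apply_restrict (mul_inv_cancel g)]

theorem toHom_act (g : G) {U V : orthBase X} (h : (orthAct X g).functor.obj U = V)
    (ρ : R.Sector U) : (act hθ g h ρ).toHom = hθ.conj g ρ.toHom := rfl

/-- The action of `g` on morphisms of localized sectors. -/
noncomputable def actHom (g : G) {U V : orthBase X} (h : (orthAct X g).functor.obj U = V)
    {ρ σ : R.Sector U} (T : ρ ⟶ σ) : act hθ g h ρ ⟶ act hθ g h σ :=
  ⟨θ g T.1, hθ.restrict_mem g h (a := opUniversal T) T.2.1, fun a => by
    have h := congrArg (θ g) (T.2.2 (hθ.restrict g⁻¹ a))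
    rw [map_mul, map_mul] at h
    exact h⟩

theorem opUniversal_actHom (g : G) {U V : orthBase X} (h : (orthAct X g).functor.obj U = V)
    {ρ σ : R.Sector U} (T : ρ ⟶ σ) :
    opUniversal (actHom hθ g h T) = hθ.restrict g (opUniversal T) := rfl

end Sector

variable [IsFiltered (orthBase X)] (hR : R.IsHaagDual) (hθ : R.IsCovariant θ)

/-- The action of `g` as a strict monoidal `*`-functor. -/
noncomputable def actFunctor (g : G) {U V : orthBase X} (h : (orthAct X g).functor.obj U = V) :
    MonStarFunctor (monSSS hR U) (monSSS hR V) where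
  obj ρ := Sector.act hθ g h ρ
  map T := Sector.actHom hθ g h T
  map_id ρ := Sector.ext_hom (map_one (θ g))
  map_comp S T := Sector.ext_hom (map_mul (θ g) T.1 S.1)
  map_add S T := Sector.ext_hom (map_add (θ g) S.1 T.1)
  map_smul z T := Sector.ext_hom (map_smul (θ g) z T.1)
  map_dagger T := Sector.ext_hom (map_star (θ g) T.1)
  obj_unit := Sector.ext (map_one (hθ.conj g))
  obj_tensor ρ σ := Sector.ext (map_mul (hθ.conj g) (Sector.toHom ρ) (Sector.toHom σ))
  map_tensor {ρ ρ' σ σ'} S T := Sector.heq_of_opUniversal_eq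
    (map_mul (hθ.conj g) (Sector.toHom ρ) (Sector.toHom σ))
    (map_mul (hθ.conj g) (Sector.toHom ρ') (Sector.toHom σ')) (by
      show hθ.restrict g (Sector.opUniversal S * Sector.toHom ρ (Sector.opUniversal T)) =
        hθ.restrict g (Sector.opUniversal S) *
          hθ.conj g (Sector.toHom ρ) (hθ.restrict g (Sector.opUniversal T))
      rw [map_mul, hθ.conj_apply, hθ.restrict_apply_restrict (inv_mul_cancel g)])

section

variable (g : G) {n : ℕ} {U U' : Fin n → orthBase X} {V V' : orthBase X}
  (hU : ∀ i, (orthAct X g).functor.obj (U i) = U' i) (hV : (orthAct X g).functor.obj V = V')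
  (f : (orthBase X).Op U V) (f' : (orthBase X).Op U' V')

/-- Conjugation is a monoid homomorphism and so respects ordered products. The arrows of an
operation do not enter the product, so f and f' may be unrelated; one statement thus serves both the
action and its inverse. -/
theorem toHom_act_factorObj (ρ : ∀ i, R.Sector (U i)) :
    (Sector.act hθ g hV (factorObj hR f ρ)).toHom =
      (factorObj hR f' fun i => Sector.act hθ g (hU i) (ρ i)).toHom := by
  rw [Sector.toHom_act, toHom_factorObj, toHom_factorObj, map_list_prod, List.map_ofFn]
  rfl

theorem opUniversal_actHom_factorHom {ρ σ : ∀ i, R.Sector (U i)} (T : ∀ i, ρ i ⟶ σ i) :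
    Sector.opUniversal (Sector.actHom hθ g hV (factorHom hR f T)) =
      Sector.opUniversal (factorHom hR f' fun i => Sector.actHom hθ g (hU i) (T i)) := by
  rw [Sector.opUniversal_actHom, opUniversal_factorHom, opUniversal_factorHom, map_list_prod,
    List.map_ofFn]
  rfl

end

/-! ### The equivariance structure. -/

variable (hC : (orthBase X).HasSeparatedTransport)

/-- The bundled prefactorization algebra of localized sectors. -/
noncomputable def sectorPFA : PFA.{v, u, u', u'} (orthBase X) := ⟨monSSS hR, pfaStr hR hC⟩

/-- The action of `g` as a morphism of prefactorization algebras. -/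
noncomputable def pfaAct (g : G) :
    sectorPFA hR hC ⟶ (PFA.pullback (orthAct X g)).obj (sectorPFA hR hC) where
  app _ := actFunctor hR hθ g rfl
  prod_obj {_ _ _} f ρ :=
    Sector.ext (toHom_act_factorObj hR hθ g (fun _ => rfl) rfl f (f.mapHom (orthAct X g)) ρ)
  prod_map {_ _ _} f {ρ σ} T := Sector.heq_of_opUniversal_eq
    (toHom_act_factorObj hR hθ g (fun _ => rfl) rfl f (f.mapHom (orthAct X g)) ρ)
    (toHom_act_factorObj hR hθ g (fun _ => rfl) rfl f (f.mapHom (orthAct X g)) σ)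
    (opUniversal_actHom_factorHom hR hθ g (fun _ => rfl) rfl f (f.mapHom (orthAct X g)) T)

/-- The inverse of the action of `g` as a morphism of prefactorization algebras. -/
noncomputable def pfaActInv (g : G) :
    (PFA.pullback (orthAct X g)).obj (sectorPFA hR hC) ⟶ sectorPFA hR hC where
  app U := actFunctor hR hθ g⁻¹ (orthAct_obj_orthAct_obj X (inv_mul_cancel g) U)
  prod_obj {_ U V} f ρ :=
    Sector.ext (toHom_act_factorObj hR hθ g⁻¹
      (fun i => orthAct_obj_orthAct_obj X (inv_mul_cancel g) (U i))
      (orthAct_obj_orthAct_obj X (inv_mul_cancel g) V) (f.mapHom (orthAct X g)) f ρ)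
  prod_map {_ U V} f {ρ σ} T := Sector.heq_of_opUniversal_eq
    (toHom_act_factorObj hR hθ g⁻¹
      (fun i => orthAct_obj_orthAct_obj X (inv_mul_cancel g) (U i))
      (orthAct_obj_orthAct_obj X (inv_mul_cancel g) V) (f.mapHom (orthAct X g)) f ρ)
    (toHom_act_factorObj hR hθ g⁻¹
      (fun i => orthAct_obj_orthAct_obj X (inv_mul_cancel g) (U i))
      (orthAct_obj_orthAct_obj X (inv_mul_cancel g) V) (f.mapHom (orthAct X g)) f σ)
    (opUniversal_actHom_factorHom hR hθ g⁻¹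
      (fun i => orthAct_obj_orthAct_obj X (inv_mul_cancel g) (U i))
      (orthAct_obj_orthAct_obj X (inv_mul_cancel g) V) (f.mapHom (orthAct X g)) f T)

section

variable {hR hC} {α β : orthBase X ⟶ orthBase X}

/-- The effect on objects of a morphism between pullbacks of the sector algebra. -/
noncomputable def appObj
    (ζ : PFA.pullbackObj α (sectorPFA hR hC) ⟶ PFA.pullbackObj β (sectorPFA hR hC))
    (U : orthBase X) (ρ : R.Sector (α.functor.obj U)) : R.Sector (β.functor.obj U) :=
  (ζ.app U).obj ρ

/-- The effect on morphisms of a morphism between pullbacks of the sector algebra. -/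
noncomputable def appHom
    (ζ : PFA.pullbackObj α (sectorPFA hR hC) ⟶ PFA.pullbackObj β (sectorPFA hR hC))
    (U : orthBase X) {ρ σ : R.Sector (α.functor.obj U)} (T : ρ ⟶ σ) :
    appObj ζ U ρ ⟶ appObj ζ U σ :=
  (ζ.app U).map T

/-- Reduces every coherence law to identities in R_⋆. With α the identity functor the source is the
sector algebra itself. -/
theorem pfaHom_ext
    {ζ ξ : PFA.pullbackObj α (sectorPFA hR hC) ⟶ PFA.pullbackObj β (sectorPFA hR hC)}
    (hobj : ∀ (U : orthBase X) (ρ : R.Sector (α.functor.obj U)),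
      (appObj ζ U ρ).toHom = (appObj ξ U ρ).toHom)
    (hmap : ∀ (U : orthBase X) (ρ σ : R.Sector (α.functor.obj U)) (T : ρ ⟶ σ),
      Sector.opUniversal (appHom ζ U T) = Sector.opUniversal (appHom ξ U T)) : ζ = ξ := by
  refine PFA.Hom.ext (funext fun U => ?_)
  have h : (ζ.app U).toFunctor = (ξ.app U).toFunctor :=
    Functor.hext (fun ρ => Sector.ext (hobj U ρ))
      (fun ρ σ T => Sector.heq_of_opUniversal_eq (hobj U ρ) (hobj U σ) (hmap U ρ σ T))
  exact MonStarFunctor.ext (congrArg (fun F => F.obj) h) (by rw [h])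

/-- Lets the `eqToHom` of the coherence laws be erased. The equality of functors is a separate
argument because it can be substituted, unlike an equality of pulled-back algebras. -/
theorem toHom_appObj_eqToHom (h : α = β)
    (h' : PFA.pullbackObj α (sectorPFA hR hC) = PFA.pullbackObj β (sectorPFA hR hC))
    (U : orthBase X) (ρ : R.Sector (α.functor.obj U)) :
    (appObj (eqToHom h') U ρ).toHom = ρ.toHom := by
  subst h
  rfl

theorem opUniversal_appHom_eqToHom (h : α = β)
    (h' : PFA.pullbackObj α (sectorPFA hR hC) = PFA.pullbackObj β (sectorPFA hR hC))
    (U : orthBase X) {ρ σ : R.Sector (α.functor.obj U)} (T : ρ ⟶ σ) :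
    Sector.opUniversal (appHom (eqToHom h') U T) = Sector.opUniversal T := by
  subst h
  rfl

end

/-- The action of `g` as an isomorphism of prefactorization algebras. -/
noncomputable def pfaActIso (g : G) :
    sectorPFA hR hC ≅ (PFA.pullback (orthAct X g)).obj (sectorPFA hR hC) where
  hom := pfaAct hR hθ hC g
  inv := pfaActInv hR hθ hC g
  hom_inv_id := pfaHom_ext (hR := hR) (hC := hC) (α := 𝟙 _) (β := 𝟙 _)
    (fun U ρ => by
      show hθ.conj g⁻¹ (hθ.conj g ρ.toHom) = ρ.toHom
      rw [hθ.conj_conj, inv_mul_cancel, hθ.conj_one])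
    (fun U ρ σ T => by
      show hθ.restrict g⁻¹ (hθ.restrict g (Sector.opUniversal T)) = Sector.opUniversal T
      rw [hθ.restrict_apply_restrict (inv_mul_cancel g)])
  inv_hom_id := pfaHom_ext (α := orthAct X g) (β := orthAct X g)
    (fun U ρ => by
      show hθ.conj g (hθ.conj g⁻¹ ρ.toHom) = ρ.toHom
      rw [hθ.conj_conj, mul_inv_cancel, hθ.conj_one])
    (fun U ρ σ T => by
      show hθ.restrict g (hθ.restrict g⁻¹ (Sector.opUniversal T)) = Sector.opUniversal T
      rw [hθ.restrict_apply_restrict (mul_inv_cancel g)])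

/-- A variable g with a proof of g = 1 accommodates the identity morphism of (BG)ᵒᵖ, which has to be
unfolded to the unit of G. -/
theorem pfaActIso_hom_one {g : G} (hg : g = 1)
    (h : sectorPFA hR hC = (PFA.pullback (orthAct X g)).obj (sectorPFA hR hC)) :
    (pfaActIso hR hθ hC g).hom = eqToHom h := by
  subst hg
  refine pfaHom_ext (hR := hR) (hC := hC) (α := 𝟙 _) (β := orthAct X 1) (fun U ρ => ?_)
    (fun U ρ σ T => ?_)
  · refine Eq.trans ?_ (toHom_appObj_eqToHom (orthAct_one X).symm h U ρ).symm
    exact hθ.conj_one ρ.toHom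
  · refine Eq.trans ?_ (opUniversal_appHom_eqToHom (orthAct_one X).symm h U T).symm
    show hθ.restrict 1 (Sector.opUniversal T) = Sector.opUniversal T
    rw [map_one]
    rfl

theorem pfaActIso_hom_mul (g g' : G)
    (h : (PFA.pullback (orthAct X (g * g'))).obj (sectorPFA hR hC) =
      (PFA.pullback (orthAct X g')).obj ((PFA.pullback (orthAct X g)).obj (sectorPFA hR hC))) :
    (pfaActIso hR hθ hC (g * g')).hom ≫ eqToHom h =
      (pfaActIso hR hθ hC g').hom ≫
        (PFA.pullback (orthAct X g')).map (pfaActIso hR hθ hC g).hom := by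
  refine pfaHom_ext (hR := hR) (hC := hC) (α := 𝟙 _) (β := orthAct X g' ≫ orthAct X g)
    (fun U ρ => ?_) (fun U ρ σ T => ?_)
  · refine (toHom_appObj_eqToHom (orthAct_mul X g g') h U
      (Sector.act hθ (g * g') rfl ρ)).trans ?_
    exact (hθ.conj_conj g g' ρ.toHom).symm
  · refine (opUniversal_appHom_eqToHom (orthAct_mul X g g') h U
      (Sector.actHom hθ (g * g') rfl T)).trans ?_
    show hθ.restrict (g * g') (Sector.opUniversal T) =
      hθ.restrict g (hθ.restrict g' (Sector.opUniversal T))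
    rw [map_mul]
    rfl

/-- The equivariance structure on the prefactorization algebra of localized sectors of a covariant
net. -/
noncomputable def equivarianceStr : EquivarianceStr X (sectorPFA hR hC) where
  iso {_ _} f := pfaActIso hR hθ hC f.unop
  iso_id _ := pfaActIso_hom_one hR hθ hC rfl _
  iso_comp f h := pfaActIso_hom_mul hR hθ hC f.unop h.unop _

end VNNet
-- Duality and covariance of the net of bicommutants.
namespace VNNet

/-- Causality comes out of duality: for U₁ ⟂ U₂ the algebra R(U₂) lies in the commutant of the
represented 𝔄(U₁), hence commutes with its bicommutant R(U₁). For the converse inclusion it suffices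
to test against represented elements, which belong to R(U'). -/
theorem isHaagDual_bicommutantNet {H : Type u'} [NormedAddCommGroup H] [InnerProductSpace ℂ H]
    [CompleteSpace H] {C : OrthCat.{v, u}} {F : C ⥤ CStarAlgCat.{w}} {c : Limits.Cocone F}
    {π : c.pt →⋆ₐ[ℂ] (H →L[ℂ] H)}
    (h : ∀ U : C, ((bicommutantNet π).alg U : Set (H →L[ℂ] H)) =
      {T | ∀ (U' V : C) (f' : U' ⟶ V) (f : U ⟶ V), C.Perp f' f →
        T ∈ Set.centralizer (Set.range (localRep π U'))}) :
    (bicommutantNet π).IsHaagDual where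
  commute {U₁ U₂ V f₁ f₂} hp S T hS hT := by
    rw [← SetLike.mem_coe] at hS hT
    rw [h U₂] at hT
    have hS' : S ∈ Set.centralizer (Set.centralizer (Set.range (localRep π U₁))) := by
      rw [← coe_bicommutant]
      exact hS
    exact (hS' T (hT U₁ V f₁ f₂ hp)).symm
  mem {U T} hT := by
    rw [← SetLike.mem_coe, h U]
    rintro U' V f' f hp _ ⟨a, rfl⟩
    refine (hT f' f hp (localRep π U' a) ?_).symm
    rw [← SetLike.mem_coe]
    show localRep π U' a ∈ (bicommutant (localRep π U') : Set (H →L[ℂ] H))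
    rw [coe_bicommutant]
    exact Set.subset_centralizer_centralizer ⟨a, rfl⟩

/-- By the defining property of Ψ_{⋆g}, the automorphism θ_g maps the represented 𝔄(U) into the
represented 𝔄(gU). Its inverse therefore maps the commutant belonging to gU into the one belonging
to U, and dualizing again gives the bicommutants. -/
theorem isCovariant_bicommutantNet {H : Type u'} [NormedAddCommGroup H] [InnerProductSpace ℂ H]
    [CompleteSpace H] {G : Type u₁} [Group G] {X : SingleObj G ⥤ OrthCat.{v, u}}
    (A : EquivariantAQFT.{w} X) {c : Limits.Cocone A.toAQFT.obj} (hc : Limits.IsColimit c)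
    {π : c.pt →⋆ₐ[ℂ] (H →L[ℂ] H)} {θ : G →* ((H →L[ℂ] H) ≃⋆ₐ[ℂ] (H →L[ℂ] H))}
    (h : ∀ (g : G) (a : c.pt), π ((A.universalAct hc g).hom a) = θ g (π a)) :
    (bicommutantNet π).IsCovariant θ := by
  intro g U T hT
  have hrep (a : A.toAQFT.obj.obj U) :
      θ g (localRep π U a) ∈ Set.range (localRep π ((orthAct X g).functor.obj U)) :=
    ⟨((A.act g).hom.hom.app U).hom a,
      (congrArg π (A.ι_universalAct hc g U a)).symm.trans (h g ((c.ι.app U).hom a))⟩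
  have hinv (S : H →L[ℂ] H) : θ g (θ g⁻¹ S) = S := by
    rw [← StarAlgEquiv.mul_apply, ← map_mul, mul_inv_cancel, map_one, StarAlgEquiv.one_apply]
  have hT' : T ∈ Set.centralizer (Set.centralizer (Set.range (localRep π U))) := by
    rw [← coe_bicommutant]
    exact hT
  rw [← SetLike.mem_coe]
  show θ g T ∈ (bicommutant (localRep π ((orthAct X g).functor.obj U)) : Set (H →L[ℂ] H))
  rw [coe_bicommutant]
  intro S hS
  have hS' : θ g⁻¹ S ∈ Set.centralizer (Set.range (localRep π U)) := by
    rintro _ ⟨a, rfl⟩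
    refine EquivLike.injective (θ g) ?_
    rw [map_mul, map_mul, hinv]
    exact hS _ (hrep a)
  -- T commutes with θ_{g⁻¹}(S); applying θ_g gives the commutation of θ_g(T) with S.
  have hcomm := congrArg (θ g) (hT' _ hS')
  rwa [map_mul, map_mul, hinv] at hcomm

end VNNet

/-! ### The main theorem. -/

theorem theorem4p5
    {G : Type u₁} [Group G]
    -- an orthogonal category with `G`-action whose underlying category is filtered
    (X : SingleObj G ⥤ OrthCat.{v, u}) [IsFiltered (orthBase X)]
    -- a `G`-equivariant AQFT, its universal algebra and a reference representation
    (A : EquivariantAQFT.{w} X)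
    (c : Limits.Cocone A.toAQFT.obj) (hc : Limits.IsColimit c)
    {H : Type u'} [NormedAddCommGroup H] [InnerProductSpace ℂ H] [CompleteSpace H]
    (π₀ : c.pt →⋆ₐ[ℂ] (H →L[ℂ] H))
    -- every object has an orthogonal complement
    (h_orth : ∀ U : orthBase X, ∃ (U' V : orthBase X) (f' : U' ⟶ V) (f : U ⟶ V),
      (orthBase X).Perp f' f)
    -- the local representations are faithful
    (h_faithful : ∀ U : orthBase X, Function.Injective (localRep π₀ U))
    -- Haag duality
    (h_haag : ∀ U : orthBase X, ((bicommutantNet π₀).alg U : Set (H →L[ℂ] H)) =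
      {T | ∀ (U' V : orthBase X) (f' : U' ⟶ V) (f : U ⟶ V), (orthBase X).Perp f' f →
        T ∈ Set.centralizer (Set.range (localRep π₀ U'))})
    -- the geometric assumption on orthogonal cospans
    (h_geom : ∀ {U₁ U₂ U : orthBase X} (f₁ : U₁ ⟶ U) (f₂ : U₂ ⟶ U), (orthBase X).Perp f₁ f₂ →
      ∃ (W V₁ V₂ U₁' U₂' : orthBase X) (k : U ⟶ W) (k₁ : V₁ ⟶ W) (k₂ : V₂ ⟶ W)
        (j₁ : U₁ ⟶ V₁) (j₁' : U₁' ⟶ V₁) (j₂ : U₂ ⟶ V₂) (j₂' : U₂' ⟶ V₂),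
        (orthBase X).Perp k₁ k₂ ∧ (orthBase X).Perp j₁' j₁ ∧ (orthBase X).Perp j₂ j₂' ∧
        (orthBase X).Perp (j₁' ≫ k₁) k ∧ (orthBase X).Perp (j₂' ≫ k₂) k)
    -- a projective unitary representation implementing the `G`-action
    (r : G →* ProjUnitary H)
    (h_impl : ∀ (g : G) (a : c.pt), π₀ ((A.universalAct hc g).hom a) = Ad (r g) (π₀ a)) :
    -- the strict monoidal structures on the `C*`-categories of localized sectors
    ∃ M : ∀ U : orthBase X, StrictMonoidal ((bicommutantNet π₀).sss U),
      (∀ (U : orthBase X) (ρ σ : (bicommutantNet π₀).Sector U),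
        ((M U).tensorObj ρ σ).toHom = ρ.toHom.comp σ.toHom) ∧
      (∀ U : orthBase X, ((M U).unit : (bicommutantNet π₀).Sector U).toHom =
        StarAlgHom.id ℂ (bicommutantNet π₀).universal) ∧
      (∀ (U : orthBase X) (ρ ρ' σ σ' : (bicommutantNet π₀).Sector U) (T : ρ ⟶ ρ') (S : σ ⟶ σ'),
        ((M U).tensorHom T S : (M U).tensorObj ρ σ ⟶ (M U).tensorObj ρ' σ').1 =
          T.1 * (ρ.toHom (VNNet.Sector.opUniversal S) : H →L[ℂ] H)) ∧
    -- the locally constant prefactorization algebra of localized sectors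
    ∃ P : PFAStr (orthBase X) (fun U => ⟨(bicommutantNet π₀).sss U, M U⟩),
      (∀ {n : ℕ} {U : Fin n → orthBase X} {V : orthBase X} (f : (orthBase X).Op U V)
        (ρ : ∀ i, (bicommutantNet π₀).Sector (U i)),
        (P.prod f).obj ρ = (M V).tensorPow n (fun i => VNNet.Sector.incl (f.1 i) (ρ i))) ∧
      (∀ {n : ℕ} {U : Fin n → orthBase X} {V : orthBase X} (f : (orthBase X).Op U V)
        {ρ σ : ∀ i, (bicommutantNet π₀).Sector (U i)}
        (T : ∀ i, ρ i ⟶ σ i),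
        HEq ((P.prod f).map T)
          ((M V).tensorPowHom n (fun i => VNNet.Sector.inclHom (f.1 i) (T i)))) ∧
      P.IsLocallyConstant ∧
    -- the `G`-equivariance structure given by the adjoint action
    ∃ (hQ : ∀ g : G, ∀ a ∈ (bicommutantNet π₀).universal,
        Ad (r g)⁻¹ a ∈ (bicommutantNet π₀).universal)
      (Ψ : EquivarianceStr X ⟨fun U => ⟨(bicommutantNet π₀).sss U, M U⟩, P⟩),
      (∀ (g : G) (U : orthBase X) (ρ : (bicommutantNet π₀).Sector U) (a : (bicommutantNet π₀).universal),
        ((((Ψ.act g).hom.app U).obj ρ : (bicommutantNet π₀).Sector ((orthAct X g).functor.obj U)).toHom a :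
            H →L[ℂ] H) =
          Ad (r g) (ρ.toHom ⟨Ad (r g)⁻¹ a, hQ g a a.2⟩)) ∧
      (∀ (g : G) (U : orthBase X) (ρ σ : (bicommutantNet π₀).Sector U) (T : ρ ⟶ σ),
        (((Ψ.act g).hom.app U).map T : (_ : (bicommutantNet π₀).Sector _) ⟶ _).1 = Ad (r g) T.1) := by
  have hC : (orthBase X).HasSeparatedTransport := fun _ _ _ f₁ f₂ hf => h_geom f₁ f₂ hf
  have hR := VNNet.isHaagDual_bicommutantNet h_haag
  have hθ := VNNet.isCovariant_bicommutantNet A hc (θ := Ad.comp r) h_impl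
  -- The claim inverts in the projective unitary group, the action on R_⋆ inverts in G.
  have hinv (g : G) : (r g)⁻¹ = r g⁻¹ := (map_inv r g).symm
  refine ⟨VNNet.strictMonoidal hR, fun _ _ _ => rfl, fun _ => rfl, fun _ _ _ _ _ _ _ => rfl,
    VNNet.pfaStr hR hC, fun {_ _ _} _ _ => rfl, fun {_ _ _} _ {_ _} _ => HEq.rfl,
    VNNet.isLocallyConstant_pfaStr hR hC, fun g a ha => ?_,
    VNNet.equivarianceStr hR hθ hC, fun g U ρ a => ?_, fun _ _ _ _ _ => rfl⟩
  · rw [hinv]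
    exact hθ.mem_universal g⁻¹ ha
  · simp only [hinv]
    rfl
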